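/- Let $R$ be a commutative ring with identity and a fixed invertible element $q^{1/2}$ such that $\alpha=q+q^{-1}$ is invertible, and put $\beta=\alpha^{-1}$. Let $\Sigma=\Sigma_{0,n+1}$ be a disk in the plane with punctures $\mathsf p_k=(k,0)$, $k=1,\dots,n$, and let $\mathcal S_n=\mathcal S(\Sigma;R)$ be its Kauffman bracket skein algebra: the $R$-module generated by isotopy classes of (possibly empty) framed links in $\Sigma\times(0,1)$ modulo the relations $L_\times=q^{1/2}L_\infty+q^{-1/2}L_0$ (where $L_\infty$ joins the two regions swept out when the over-strand is turned counterclockwise) and $L\sqcup\bigcirc=-(q+q^{-1})L$, with product $L_1L_2$ given by placing $L_1$ above $L_2$, and unit the empty link. For distinct $i_1,\dots,i_r$ let $t_{i_1\cdots i_r}\in\mathcal S_n$ be the simple closed curve (with vertical framing) that encloses exactly $\mathsf p_{i_1},\dots,\mathsf p_{i_r}$ and passes below every other puncture lying between them. Put $$s_{ij}=t_{ij}+\beta t_it_j\ (i\ne j),\qquad s_{ii}=\alpha-\beta t_i^2,$$ $$s_{ijk}=t_{ijk}+\beta(t_it_{jk}+t_jt_{ik}+t_kt_{ij})+2\beta^2t_it_jt_k\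 \ (i,j,k\text{ distinct}).$$ Say that $(i_1,\dots,i_m)$, with entries in $\{1,\dots,n\}$, is in cyclic order if it is a cyclic rotation of a strictly increasing sequence. Then the following hold in $\mathcal S_n$. (a) For $(i_1,i_2,i_3,i_4,i_5)$ in cyclic order, $$q^2s_{i_1i_5}s_{i_2i_3i_4}-s_{i_2i_5}s_{i_1i_3i_4}+s_{i_3i_5}s_{i_1i_2i_4}-q^{-2}s_{i_4i_5}s_{i_1i_2i_3}=(q-q^{-1})\big(q^{-1}s_{i_1i_2}s_{i_3i_4i_5}+q\,s_{i_3i_4}s_{i_1i_2i_5}\big).$$ (b) For $(i_1,i_2,i_3,i_4)$ in cyclic order, $$q^2s_{i_1i_2}s_{i_1i_3i_4}-s_{i_1i_3}s_{i_1i_2i_4}+q^{-2}s_{i_1i_4}s_{i_1i_2i_3}-(q^2+q^{-2}-1)s_{i_1i_1}s_{i_2i_3i_4}$$ $$=(q-q^{-1})^2\beta\,t_{i_1}\big(s_{i_1i_3}s_{i_2i_4}-q^2s_{i_1i_2}s_{i_3i_4}-q^{-2}s_{i_1i_4}s_{i_2i_3}\big).$$ (c) If $q^2=1$ in $R$, then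 the classical type II relations hold: for all $1\le c\le n$ and $1\le a_1<a_2<a_3<a_4\le n$, $$s_{a_1c}s_{a_2a_3a_4}-s_{a_2c}s_{a_1a_3a_4}+s_{a_3c}s_{a_1a_2a_4}-s_{a_4c}s_{a_1a_2a_3}=0.$$ -/

import Mathlib

/-!
# The Kauffman bracket skein algebra of the `n`-punctured disk

`Σ = Σ_{0,n+1}` is a disk in the plane with the punctures `p_k = (k, 0)`, `1 ≤ k ≤ n` (here indexed
by `Fin n`). Framed links in `Σ × (0,1)` are presented by link diagrams on `Σ` (vertical framing),
modulo planar isotopy of `Σ` and the framed Reidemeister moves. A diagram in general position is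
recorded by sweeping it with a vertical line from left to right: the line meets the diagram in
finitely many strands, numbered `0, 1, 2, …` from bottom to top, and passes one elementary event
(a `Slice`) at a time.
-/

namespace Skein

/-- The elementary events met by the sweeping line.
* `cup`: a local minimum of the `x`-coordinate; two new strands appear.
* `cap`: a local maximum of the `x`-coordinate; two adjacent strands are joined and disappear.
* `cross risingOver`: two adjacent strands cross, the lower one rising and the upper one descending;
  the rising strand is the over-strand iff `risingOver = true`.
* `puncture`: the line passes a puncture of the surface. -/
inductive Kind : Type
  | cup : Kind
  | cap : Kind
  | cross (risingOver : Bool) : Kind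
  | puncture : Kind
  deriving DecidableEq

/-- Number of strands entering an event from the left. -/
def Kind.ins : Kind → ℕ
  | .cup => 0
  | .cap => 2
  | .cross _ => 2
  | .puncture => 0

/-- Number of strands leaving an event to the right. -/
def Kind.outs : Kind → ℕ
  | .cup => 2
  | .cap => 0
  | .cross _ => 2
  | .puncture => 0

/-- An event together with its height: `pos` is the number of strands that pass below it. -/
structure Slice : Type where
  kind : Kind
  pos : ℕ
  deriving DecidableEq

def cup (i : ℕ) : Slice := ⟨.cup, i⟩
def cap (i : ℕ) : Slice := ⟨.cap, i⟩
def cross (risingOver : Bool) (i : ℕ) : Slice := ⟨.cross risingOver, i⟩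
def puncture (i : ℕ) : Slice := ⟨.puncture, i⟩

/-- `Closes m w`: starting from `m` strands, the events of `w` can be performed one after the other
and no strand is left at the end. -/
def Closes : ℕ → List Slice → Prop
  | m, [] => m = 0
  | m, s :: w => s.pos + s.kind.ins ≤ m ∧ Closes (m - s.kind.ins + s.kind.outs) w

/-- A (possibly empty) link diagram on the disk with `n` punctures: a sequence of events that starts
and ends with no strands and passes exactly `n` punctures. The `k`-th puncture event is the
puncture `p_k`. -/
@[ext] structure LinkDiagram (n : ℕ) : Type where
  word : List Slice
  closes : Closes 0 word
  punctures : word.countP (fun s => s.kind = Kind.puncture) = n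

/-- The local moves generating isotopy of framed links in `Σ × (0,1)`. -/
inductive LocalMove : List Slice → List Slice → Prop
  /-- Planar isotopy: two consecutive events at different heights are interchanged (`g` is the lower
  one, `d` is the number of strands between them). Two punctures are never interchanged. -/
  | exchange (g h : Kind) (i d : ℕ) (hgh : ¬ (g = Kind.puncture ∧ h = Kind.puncture)) :
      LocalMove [⟨g, i⟩, ⟨h, i + g.outs + d⟩] [⟨h, i + g.ins + d⟩, ⟨g, i⟩]
  /-- Planar isotopy: straightening a zigzag. -/
  | zigzag (i : ℕ) : LocalMove [cup i, cap (i + 1)] []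
  | zigzag' (i : ℕ) : LocalMove [cup (i + 1), cap i] []
  /-- Planar isotopy: rotating a crossing past a local extremum. -/
  | rotateCup (f : Bool) (i : ℕ) :
      LocalMove [cup i, cross f (i + 1)] [cup (i + 1), cross (!f) i]
  | rotateCap (f : Bool) (i : ℕ) :
      LocalMove [cross f (i + 1), cap i] [cross (!f) i, cap (i + 1)]
  /-- Framed Reidemeister move I: a curl may be replaced by the curl of the same sign on the other
  side of the strand. -/
  | reidemeister₁ (f : Bool) (i : ℕ) :
      LocalMove [cup (i + 1), cross f i, cap (i + 1)] [cup i, cross f (i + 1), cap i]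
  /-- Reidemeister move II. -/
  | reidemeister₂ (f : Bool) (i : ℕ) : LocalMove [cross f i, cross (!f) i] []
  /-- Reidemeister move III. With the three strands `a, b, c` from bottom to top on the left,
  `f₁, f₂, f₃` say whether `a` is over `b`, `a` is over `c`, `b` is over `c`; the hypothesis says
  that the three strands lie at three linearly ordered levels. -/
  | reidemeister₃ (f₁ f₂ f₃ : Bool) (i : ℕ) (hf : f₁ = f₃ → f₂ = f₁) :
      LocalMove [cross f₁ i, cross f₂ (i + 1), cross f₃ i]
        [cross f₃ (i + 1), cross f₂ i, cross f₁ (i + 1)]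

/-- `Superposed c w₁ w₂ w`: the sequence of events `w` is obtained by drawing `w₁` above `w₂`. Here
`c` lists the strands at the present position of the sweeping line from bottom to top, with `true`
for the strands of `w₁` and `false` for those of `w₂`. Wherever a strand of `w₁` crosses a strand of
`w₂`, the former is the over-strand; the puncture events are shared. -/
inductive Superposed : List Bool → List Slice → List Slice → List Slice → Prop
  | nil : Superposed [] [] [] []
  /-- an event of the upper link -/
  | upper (a b : List Bool) (k : Kind) (hk : k ≠ Kind.puncture) (w₁ w₂ w : List Slice) :
      Superposed (a ++ List.replicate k.outs true ++ b) w₁ w₂ w →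
      Superposed (a ++ List.replicate k.ins true ++ b)
        (⟨k, a.count true⟩ :: w₁) w₂ (⟨k, a.length⟩ :: w)
  /-- an event of the lower link -/
  | lower (a b : List Bool) (k : Kind) (hk : k ≠ Kind.puncture) (w₁ w₂ w : List Slice) :
      Superposed (a ++ List.replicate k.outs false ++ b) w₁ w₂ w →
      Superposed (a ++ List.replicate k.ins false ++ b)
        w₁ (⟨k, a.count false⟩ :: w₂) (⟨k, a.length⟩ :: w)
  /-- a puncture -/
  | puncture (a b : List Bool) (w₁ w₂ w : List Slice) :
      Superposed (a ++ b) w₁ w₂ w →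
      Superposed (a ++ b) (puncture (a.count true) :: w₁) (puncture (a.count false) :: w₂)
        (puncture a.length :: w)
  /-- a rising strand of the upper link crosses over a descending strand of the lower link -/
  | upperRises (a b : List Bool) (w₁ w₂ w : List Slice) :
      Superposed (a ++ [false, true] ++ b) w₁ w₂ w →
      Superposed (a ++ [true, false] ++ b) w₁ w₂ (cross true a.length :: w)
  /-- a descending strand of the upper link crosses over a rising strand of the lower link -/
  | lowerRises (a b : List Bool) (w₁ w₂ w : List Slice) :
      Superposed (a ++ [true, false] ++ b) w₁ w₂ w →
      Superposed (a ++ [false, true] ++ b) w₁ w₂ (cross false a.length :: w)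

section Algebra

variable (R : Type*) [CommRing R] (A : Rˣ) (n : ℕ)

/-- The defining relations of the skein algebra, where `A = q^{1/2}`: the generators are the link
diagrams; isotopic framed links are identified; the skein relation
`[crossing] = q^{1/2} [∞-resolution] + q^{-1/2} [0-resolution]` (the `∞`-resolution joins the two
regions swept by turning the over-strand counterclockwise) and `[L ⊔ trivial circle] = -(q+q⁻¹) [L]`
hold; the empty link is `1`; and the product `L₁ L₂` is the link obtained by placing `L₁` above
`L₂`. -/
inductive Rel : FreeAlgebra R (LinkDiagram n) → FreeAlgebra R (LinkDiagram n) → Prop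
  | isotopy (D D' : LinkDiagram n) (u v x y : List Slice) (hxy : LocalMove x y)
      (hD : D.word = u ++ x ++ v) (hD' : D'.word = u ++ y ++ v) :
      Rel (FreeAlgebra.ι R D) (FreeAlgebra.ι R D')
  /-- rising over-strand: the `∞`-resolution is a cap followed by a cup -/
  | skeinRising (D D₁ D₂ : LinkDiagram n) (u v : List Slice) (i : ℕ)
      (hD : D.word = u ++ [cross true i] ++ v)
      (hD₁ : D₁.word = u ++ [cap i, cup i] ++ v) (hD₂ : D₂.word = u ++ v) :
      Rel (FreeAlgebra.ι R D)
        ((A : R) • FreeAlgebra.ι R D₁ + ((A⁻¹ : Rˣ) : R) • FreeAlgebra.ι R D₂)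
  /-- descending over-strand: the `∞`-resolution consists of two parallel horizontal strands -/
  | skeinDescending (D D₁ D₂ : LinkDiagram n) (u v : List Slice) (i : ℕ)
      (hD : D.word = u ++ [cross false i] ++ v)
      (hD₁ : D₁.word = u ++ v) (hD₂ : D₂.word = u ++ [cap i, cup i] ++ v) :
      Rel (FreeAlgebra.ι R D)
        ((A : R) • FreeAlgebra.ι R D₁ + ((A⁻¹ : Rˣ) : R) • FreeAlgebra.ι R D₂)
  | circle (D D' : LinkDiagram n) (u v : List Slice) (i : ℕ)
      (hD : D.word = u ++ [cup i, cap i] ++ v) (hD' : D'.word = u ++ v) :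
      Rel (FreeAlgebra.ι R D)
        ((-((A : R) ^ 2 + ((A⁻¹ : Rˣ) : R) ^ 2)) • FreeAlgebra.ι R D')
  | empty (D : LinkDiagram n) (hD : D.word = List.replicate n (puncture 0)) :
      Rel (FreeAlgebra.ι R D) 1
  | stack (D₁ D₂ D : LinkDiagram n) (h : Superposed [] D₁.word D₂.word D.word) :
      Rel (FreeAlgebra.ι R D₁ * FreeAlgebra.ι R D₂) (FreeAlgebra.ι R D)

/-- The Kauffman bracket skein algebra `S(Σ_{0,n+1}; R)` with respect to `A = q^{1/2}`. -/
abbrev SkeinAlgebra : Type _ := RingQuot (Rel R A n)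

end Algebra

/-- The number of strands lying below the puncture `p_k` in the curve `t_I`: the curve consists of
two strands between its extreme punctures; it encloses `p_k` if `k ∈ I`, and otherwise both strands
pass below `p_k`, so that the curve avoids the vertical ray going up from `p_k`. -/
def strandsBelow {n : ℕ} (I : Finset (Fin n)) (k : Fin n) : ℕ :=
  if k ∈ I then 1 else if (∃ a ∈ I, a < k) ∧ (∃ b ∈ I, k < b) then 2 else 0

/-- The part of the curve `t_I` near the line `x = k`. -/
def curveAt {n : ℕ} (I : Finset (Fin n)) (k : Fin n) : List Slice :=
  (if k ∈ I ∧ ∀ a ∈ I, k ≤ a then [cup 0] else []) ++ [puncture (strandsBelow I k)] ++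
    (if k ∈ I ∧ ∀ a ∈ I, a ≤ k then [cap 0] else [])

theorem closes_curve {n : ℕ} (I : Finset (Fin n)) (l : List (Fin n)) (hl : l.Pairwise (· < ·))
    (hlow : ∀ a, a ∉ l → ∀ b ∈ l, a < b) :
    Closes (if (∃ a ∈ I, a ∉ l) ∧ (∃ b ∈ I, b ∈ l) then 2 else 0) (l.flatMap (curveAt I)) := by
  induction l with
  | nil => simp [Closes]
  | cons k l ih =>
    have hkl : ∀ b ∈ l, k < b := (List.pairwise_cons.1 hl).1
    have ih' := ih (List.pairwise_cons.1 hl).2 (by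
      intro a ha b hb
      by_cases hak : a = k
      · exact hak ▸ hkl b hb
      · exact hlow a (by simp [hak, ha]) b (by simp [hb]))
    have hout : ∀ a, a ∉ k :: l ↔ a < k := fun a =>
      ⟨fun h => hlow a h k (by simp), fun h h' => by
        rcases List.mem_cons.1 h' with h'' | h''
        · exact absurd h (by simp [h''])
        · exact lt_asymm h (hkl a h'')⟩
    have hin : ∀ b, b ∈ l ↔ k < b := fun b =>
      ⟨hkl b, fun h => by
        by_contra hb
        have : b < k := (hout b).1 (by simp [hb, h.ne'])
        exact lt_asymm h this⟩
    have e1 : (∃ a ∈ I, a ∉ l) ↔ ((∃ a ∈ I, a < k) ∨ k ∈ I) := by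
      constructor
      · rintro ⟨a, ha, h⟩
        rw [hin, not_lt] at h
        rcases h.lt_or_eq with h | h
        · exact Or.inl ⟨a, ha, h⟩
        · exact Or.inr (h ▸ ha)
      · rintro (⟨a, ha, h⟩ | h)
        · exact ⟨a, ha, by rw [hin]; exact lt_asymm h⟩
        · exact ⟨k, h, by rw [hin]; exact lt_irrefl k⟩
    have e2 : (∃ b ∈ I, b ∈ k :: l) ↔ (k ∈ I ∨ ∃ b ∈ I, k < b) := by
      constructor
      · rintro ⟨b, hb, h⟩
        rcases List.mem_cons.1 h with h | h
        · exact Or.inl (h ▸ hb)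
        · exact Or.inr ⟨b, hb, (hin b).1 h⟩
      · rintro (h | ⟨b, hb, h⟩)
        · exact ⟨k, h, by simp⟩
        · exact ⟨b, hb, by simp [(hin b).2 h]⟩
    have e3 : (∀ a ∈ I, k ≤ a) ↔ ¬ ∃ a ∈ I, a < k := by push Not; rfl
    have e4 : (∀ a ∈ I, a ≤ k) ↔ ¬ ∃ b ∈ I, k < b := by push Not; rfl
    simp only [e1] at ih'
    simp only [hin] at ih'
    rw [List.flatMap_cons]
    simp only [hout, e2, curveAt, strandsBelow, e3, e4]
    by_cases hp : ∃ a ∈ I, a < k <;> by_cases hs : ∃ b ∈ I, k < b <;> by_cases hm : k ∈ I <;>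
      simp only [hp, hs, hm] at ih' ⊢ <;>
      simpa [Closes, cup, cap, puncture, Kind.ins, Kind.outs] using ih'

theorem countP_curve {n : ℕ} (I : Finset (Fin n)) (l : List (Fin n)) :
    (l.flatMap (curveAt I)).countP (fun s => s.kind = Kind.puncture) = l.length := by
  induction l with
  | nil => rfl
  | cons k l ih =>
    rw [List.flatMap_cons, List.countP_append, ih, List.length_cons, add_comm]
    congr 1
    unfold curveAt
    split_ifs <;> simp [cup, cap, puncture]

/-- The simple closed curve that is the outer boundary of the subsurface `Σ(I)`, for nonempty `I`
(for `I = ∅` this is the empty link). -/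
def curve {n : ℕ} (I : Finset (Fin n)) : LinkDiagram n where
  word := (List.finRange n).flatMap (curveAt I)
  closes := by
    have h := closes_curve I (List.finRange n) (List.pairwise_lt_finRange n) (by simp)
    simpa using h
  punctures := by rw [countP_curve, List.length_finRange]

section Elements

variable {R : Type*} [CommRing R] (A : Rˣ) (β : R) {n : ℕ}

/-- The element `t_I` of the skein algebra; `t_{i_1 ⋯ i_r}` is `t A {i_1, …, i_r}`. -/
def t (I : Finset (Fin n)) : SkeinAlgebra R A n :=
  RingQuot.mkAlgHom R (Rel R A n) (FreeAlgebra.ι R (curve I))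

/-- `s_{ij} = t_{ij} + β t_i t_j` for `i ≠ j`, and `s_{ii} = α - β t_i²`, where `α = q + q⁻¹`,
`q = A²` (and `β = α⁻¹`). -/
def s₂ (i j : Fin n) : SkeinAlgebra R A n :=
  if i = j then algebraMap R _ ((A : R) ^ 2 + ((A⁻¹ : Rˣ) : R) ^ 2) - β • t A {i} ^ 2
  else t A {i, j} + β • (t A {i} * t A {j})

/-- `s_{ijk} = t_{ijk} + β (t_i t_{jk} + t_j t_{ik} + t_k t_{ij}) + 2 β² t_i t_j t_k`,
for distinct `i, j, k`. -/
def s₃ (i j k : Fin n) : SkeinAlgebra R A n :=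
  t A {i, j, k} + β • (t A {i} * t A {j, k} + t A {j} * t A {i, k} + t A {k} * t A {i, j})
    + (2 * β ^ 2) • (t A {i} * t A {j} * t A {k})

end Elements

/-- `(i_1, …, i_m)` is in cyclic order: it is a cyclic rotation of a strictly increasing tuple. -/
def CyclicOrder {m n : ℕ} (i : Fin m → Fin n) : Prop :=
  ∃ a : Fin m → Fin n, StrictMono a ∧ ∃ v : ℕ, i = a ∘ ⇑(finRotate m ^ v)

end Skein

/-!
Write `xᵢ = tᵢ`, which is central, and let `τ_J = t_J`, except that `τ_∅ = -(q + q⁻¹)` is the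
trivial circle. Then `s_{ij}` (`i ≠ j`) and `s_{ijk}` are values of the single expression
`s_I = ∑_{J ⊆ I} (∏_{i ∈ I \ J} β xᵢ) τ_J`, and for `(0, …, 4)` in cyclic order
`s_{02} s_{13} = q² s_{01} s_{23} + q⁻² s_{03} s_{12} + α s_{0123}`,
`s_{02} s_{134} = q² s_{01} s_{234} + q⁻² s_{12} s_{034} + s_{34} s_{012} + α s_{01234}`.
Two cyclic rotations of the second relation contain the same `α s_{01234}`, and their difference
is (a). The left-hand side of (b) equals `(q - q⁻¹)² t_0 s_{0123}`, and the first relation expresses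
`α s_{0123}`. At `q² = 1` the type II relation is (a) if `c` differs from all `aₖ`, and (b)
otherwise, as its left-hand side only changes sign when the `aₖ` are rotated.

All of this rests on a few relations between products of the `t_I`. Smoothing every crossing of a
product and straightening the resulting planar diagrams gives a combination of diagrams that is
computed mechanically, and the two sides agree for punctures `0, …, m`. Inserting further
punctures above all the strands is an algebra homomorphism, which carries the relations to arbitrary
punctures.
-/

namespace Skein

/-! ### Words of events and the links they present -/

/-- The number of punctures passed by a word of events. -/
def punctureCount (w : List Slice) : ℕ := w.countP fun s => s.kind = Kind.puncture

@[simp] theorem punctureCount_nil : punctureCount [] = 0 := rfl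

@[simp] theorem punctureCount_append (u v : List Slice) :
    punctureCount (u ++ v) = punctureCount u + punctureCount v := List.countP_append

theorem punctureCount_cons (s : Slice) (w : List Slice) :
    punctureCount (s :: w) = (if s.kind = Kind.puncture then 1 else 0) + punctureCount w := by
  simp [punctureCount, List.countP_cons, add_comm]

/-- The number of strands to the right of a word of events that is entered by `m` strands. -/
def width (m : ℕ) (w : List Slice) : ℕ := w.foldl (fun m s => m - s.kind.ins + s.kind.outs) m

/-- The events of a word can be performed one after the other, starting from `m` strands. -/
def Fits : ℕ → List Slice → Prop
  | _, [] => True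
  | m, s :: w => s.pos + s.kind.ins ≤ m ∧ Fits (m - s.kind.ins + s.kind.outs) w

theorem closes_append {m : ℕ} {u v : List Slice} :
    Closes m (u ++ v) ↔ Fits m u ∧ Closes (width m u) v := by
  induction u generalizing m with
  | nil => simp [Fits, width]
  | cons s u ih => simp [Closes, Fits, width, ih, and_assoc]

theorem Closes.replace {m : ℕ} {u x y v : List Slice} (h : Closes m (u ++ x ++ v))
    (hxy : ∀ k, Closes k (x ++ v) → Closes k (y ++ v)) : Closes m (u ++ y ++ v) := by
  rw [List.append_assoc, closes_append] at h ⊢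
  exact h.imp_right (hxy _)

/-- The word `w` presents a link diagram on the disk with `n` punctures. -/
structure IsDiagram (n : ℕ) (w : List Slice) : Prop where
  closes : Closes 0 w
  punctures : punctureCount w = n

theorem IsDiagram.replace {n : ℕ} {u x y v : List Slice} (h : IsDiagram n (u ++ x ++ v))
    (hxy : ∀ k, Closes k (x ++ v) → Closes k (y ++ v)) (hp : punctureCount y = punctureCount x) :
    IsDiagram n (u ++ y ++ v) :=
  ⟨h.closes.replace hxy, by simpa [hp] using h.punctures⟩

theorem isDiagram_word {n : ℕ} (D : LinkDiagram n) : IsDiagram n D.word := ⟨D.closes, D.punctures⟩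

theorem isDiagram_replicate (n : ℕ) : IsDiagram n (List.replicate n (puncture 0)) where
  closes := by
    induction n with
    | zero => rfl
    | succ n ih => exact ⟨le_rfl, ih⟩
  punctures := by simp [punctureCount, puncture, List.countP_replicate]

section Bracket

variable (R : Type*) [CommRing R] (A : Rˣ) (n : ℕ)

open Classical in
/-- The element of the skein algebra presented by a word of events, with the junk value `0` when
the word is not a diagram on the disk with `n` punctures. -/
noncomputable def bracket (w : List Slice) : SkeinAlgebra R A n :=
  if h : IsDiagram n w then
    RingQuot.mkAlgHom R (Rel R A n) (FreeAlgebra.ι R ⟨w, h.closes, h.punctures⟩)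
  else 0

/-- The value `-(q + q⁻¹)` of a trivial circle. -/
def circleValue : R := -((A : R) ^ 2 + ((A⁻¹ : Rˣ) : R) ^ 2)

variable {R A n}

theorem IsDiagram.bracket_eq {w : List Slice} (h : IsDiagram n w) :
    bracket R A n w =
      RingQuot.mkAlgHom R (Rel R A n) (FreeAlgebra.ι R ⟨w, h.closes, h.punctures⟩) :=
  dif_pos h

theorem bracket_word (D : LinkDiagram n) :
    bracket R A n D.word = RingQuot.mkAlgHom R (Rel R A n) (FreeAlgebra.ι R D) :=
  (isDiagram_word D).bracket_eq

theorem bracket_curve (I : Finset (Fin n)) : bracket R A n (curve I).word = t A I :=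
  bracket_word _

theorem LocalMove.punctureCount_le_one {x y : List Slice} (h : LocalMove x y) :
    Skein.punctureCount x ≤ 1 := by
  cases h with
  | exchange g h i d hgh =>
    simp only [punctureCount_cons, punctureCount_nil]
    split_ifs with hg hh
    · exact absurd ⟨hg, hh⟩ hgh
    all_goals decide
  | _ => exact Nat.zero_le _

theorem bracket_localMove {u v x y : List Slice} (hxy : LocalMove x y)
    (hx : IsDiagram n (u ++ x ++ v)) (hy : IsDiagram n (u ++ y ++ v)) :
    bracket R A n (u ++ x ++ v) = bracket R A n (u ++ y ++ v) := by
  rw [hx.bracket_eq, hy.bracket_eq]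
  exact RingQuot.mkAlgHom_rel R (.isotopy _ _ u v x y hxy rfl rfl)

theorem closes_smoothing {m i : ℕ} {f : Bool} {v : List Slice} (h : Closes m (cross f i :: v)) :
    Closes m (cap i :: cup i :: v) ∧ Closes m v := by
  obtain ⟨h₁, h₂⟩ := h
  simp only [cross, Kind.ins, Kind.outs] at h₁ h₂
  rw [show m - 2 + 2 = m by omega] at h₂
  refine ⟨⟨h₁, ?_, ?_⟩, h₂⟩
  · simp only [cup, cap, Kind.ins, Kind.outs]; omega
  · simpa only [cup, cap, Kind.ins, Kind.outs, Nat.add_zero, Nat.sub_zero,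
      show m - 2 + 2 = m by omega] using h₂

theorem IsDiagram.smoothing {i : ℕ} {f : Bool} {u v : List Slice}
    (h : IsDiagram n (u ++ cross f i :: v)) :
    IsDiagram n (u ++ cap i :: cup i :: v) ∧ IsDiagram n (u ++ v) := by
  rw [List.append_cons] at h
  constructor
  · simpa using h.replace (y := [cap i, cup i]) (fun _ h => (closes_smoothing h).1) rfl
  · simpa using h.replace (y := []) (fun _ h => (closes_smoothing h).2) rfl

theorem bracket_cross {i : ℕ} {f : Bool} {u v : List Slice}
    (h : IsDiagram n (u ++ cross f i :: v)) :
    bracket R A n (u ++ cross f i :: v) =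
      ((A ^ (if f then 1 else -1 : ℤ) : Rˣ) : R) • bracket R A n (u ++ cap i :: cup i :: v) +
      ((A ^ (if f then -1 else 1 : ℤ) : Rˣ) : R) • bracket R A n (u ++ v) := by
  obtain ⟨h₁, h₂⟩ := h.smoothing
  rw [h.bracket_eq, h₁.bracket_eq, h₂.bracket_eq, ← map_smul, ← map_smul, ← map_add]
  cases f
  · rw [add_comm]
    simpa using RingQuot.mkAlgHom_rel R
      (Rel.skeinDescending (A := A) ⟨_, h.1, h.2⟩ ⟨_, h₂.1, h₂.2⟩ ⟨_, h₁.1, h₁.2⟩ u v i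
        (by simp) rfl (by simp))
  · simpa using RingQuot.mkAlgHom_rel R
      (Rel.skeinRising (A := A) ⟨_, h.1, h.2⟩ ⟨_, h₁.1, h₁.2⟩ ⟨_, h₂.1, h₂.2⟩ u v i
        (by simp) (by simp) rfl)

theorem bracket_circle {i : ℕ} {u v : List Slice} (h : IsDiagram n (u ++ [cup i, cap i] ++ v))
    (h' : IsDiagram n (u ++ v)) :
    bracket R A n (u ++ [cup i, cap i] ++ v) = circleValue R A • bracket R A n (u ++ v) := by
  rw [h.bracket_eq, h'.bracket_eq, ← map_smul]
  exact RingQuot.mkAlgHom_rel R (.circle ⟨_, h.1, h.2⟩ ⟨_, h'.1, h'.2⟩ u v i rfl rfl)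

theorem bracket_replicate : bracket R A n (List.replicate n (puncture 0)) = 1 := by
  rw [(isDiagram_replicate n).bracket_eq, ← map_one (RingQuot.mkAlgHom R (Rel R A n))]
  exact RingQuot.mkAlgHom_rel R (.empty _ rfl)

theorem Superposed.closes {c : List Bool} {w₁ w₂ w : List Slice} (h : Superposed c w₁ w₂ w) :
    Closes c.length w := by
  induction h with
  | nil => rfl
  | upper a b k hk w₁ w₂ w _ ih | lower a b k hk w₁ w₂ w _ ih =>
    simp only [List.length_append, List.length_replicate] at ih ⊢
    refine ⟨by simp, ?_⟩
    convert ih using 1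
    simp only
    omega
  | puncture a b _ _ w _ ih => exact ⟨by simp [Skein.puncture, Kind.ins], ih⟩
  | upperRises a b w₁ w₂ w _ ih | lowerRises a b w₁ w₂ w _ ih =>
    simp only [List.length_append] at ih ⊢
    refine ⟨by simp [cross, Kind.ins], ?_⟩
    convert ih using 1
    simp only [List.length_cons, cross, Kind.ins, Kind.outs]
    omega

theorem Superposed.punctureCount {c : List Bool} {w₁ w₂ w : List Slice}
    (h : Superposed c w₁ w₂ w) : punctureCount w₂ = punctureCount w := by
  induction h with
  | nil => rfl
  | upper a b k hk w₁ w₂ w _ ih | lower a b k hk w₁ w₂ w _ ih =>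
    simpa [punctureCount_cons, hk] using ih
  | puncture a b w₁ w₂ w _ ih => simpa [punctureCount_cons, Skein.puncture] using ih
  | upperRises a b w₁ w₂ w _ ih | lowerRises a b w₁ w₂ w _ ih =>
    simpa [punctureCount_cons, cross] using ih

theorem Superposed.isDiagram {w₁ w₂ w : List Slice} (h : Superposed [] w₁ w₂ w)
    (h₂ : IsDiagram n w₂) : IsDiagram n w :=
  ⟨h.closes, h.punctureCount.symm.trans h₂.punctures⟩

theorem bracket_mul {w₁ w₂ w : List Slice} (h₁ : IsDiagram n w₁) (h₂ : IsDiagram n w₂)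
    (h : Superposed [] w₁ w₂ w) :
    bracket R A n w₁ * bracket R A n w₂ = bracket R A n w := by
  rw [h₁.bracket_eq, h₂.bracket_eq, (h.isDiagram h₂).bracket_eq, ← map_mul]
  exact RingQuot.mkAlgHom_rel R (.stack _ _ _ h)

end Bracket

/-! ### Simplification of words -/

/-- The local moves used to simplify a word: `Shrink x c y` replaces `x` by `y` and removes `c`
trivial circles. Unlike those of `LocalMove`, these moves never spoil the heights of the events. -/
inductive Shrink : List Slice → ℕ → List Slice → Prop
  | exchange (g h : Kind) (i d : ℕ) (hgh : ¬ (g = Kind.puncture ∧ h = Kind.puncture)) :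
      Shrink [⟨g, i⟩, ⟨h, i + g.outs + d⟩] 0 [⟨h, i + g.ins + d⟩, ⟨g, i⟩]
  | exchange' (g h : Kind) (i d : ℕ) (hgh : ¬ (g = Kind.puncture ∧ h = Kind.puncture)) :
      Shrink [⟨h, i + g.ins + d⟩, ⟨g, i⟩] 0 [⟨g, i⟩, ⟨h, i + g.outs + d⟩]
  | zigzag (i : ℕ) : Shrink [cup i, cap (i + 1)] 0 []
  | zigzag' (i : ℕ) : Shrink [cup (i + 1), cap i] 0 []
  | cancel (f : Bool) (i : ℕ) : Shrink [cross f i, cross (!f) i] 0 []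
  | circle (i : ℕ) : Shrink [cup i, cap i] 1 []

/-- `Simplify w c w'`: finitely many `Shrink` moves inside `w` lead to `w'` and remove `c` trivial
circles in total. -/
inductive Simplify : List Slice → ℕ → List Slice → Prop
  | refl (w : List Slice) : Simplify w 0 w
  | trans {w w' w'' : List Slice} {c d : ℕ} :
      Simplify w c w' → Simplify w' d w'' → Simplify w (c + d) w''
  | shrink (u v : List Slice) {x y : List Slice} {c : ℕ} : Shrink x c y →
      Simplify (u ++ x ++ v) c (u ++ y ++ v)

theorem Shrink.punctureCount {x y : List Slice} {c : ℕ} (h : Shrink x c y) :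
    punctureCount y = punctureCount x := by
  cases h <;> simp [punctureCount_cons, cup, cap, cross, add_comm]

theorem Shrink.closes {x y v : List Slice} {c m : ℕ} (h : Shrink x c y)
    (hx : Closes m (x ++ v)) : Closes m (y ++ v) := by
  cases h with
  | exchange g h i d | exchange' g h i d =>
    obtain ⟨h₁, h₂, h₃⟩ := hx
    simp only at h₁ h₂ h₃
    refine ⟨by simp only; omega, by simp only; omega, ?_⟩
    convert h₃ using 1
    simp only
    omega
  | zigzag i | zigzag' i | circle i => simpa [Closes, cup, cap, Kind.ins, Kind.outs] using hx.2.2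
  | cancel f i =>
    obtain ⟨h₁, h₂, h₃⟩ := hx
    simp only [cross, Kind.ins, Kind.outs] at h₁ h₂ h₃
    rwa [show m - 2 + 2 - 2 + 2 = m by omega] at h₃

theorem Shrink.isDiagram {u v x y : List Slice} {c n : ℕ} (h : Shrink x c y)
    (hx : IsDiagram n (u ++ x ++ v)) : IsDiagram n (u ++ y ++ v) :=
  hx.replace (fun _ => h.closes) h.punctureCount

theorem Shrink.bracket_eq {R : Type*} [CommRing R] {A : Rˣ} {u v x y : List Slice} {c n : ℕ}
    (h : Shrink x c y) (hx : IsDiagram n (u ++ x ++ v)) :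
    bracket R A n (u ++ x ++ v) = circleValue R A ^ c • bracket R A n (u ++ y ++ v) := by
  have hy := h.isDiagram hx
  cases h with
  | exchange g h i d hgh => simpa using bracket_localMove (.exchange g h i d hgh) hx hy
  | exchange' g h i d hgh => simpa using (bracket_localMove (.exchange g h i d hgh) hy hx).symm
  | zigzag i => simpa using bracket_localMove (.zigzag i) hx hy
  | zigzag' i => simpa using bracket_localMove (.zigzag' i) hx hy
  | cancel f i => simpa using bracket_localMove (.reidemeister₂ f i) hx hy
  | circle i => simpa using bracket_circle hx (by simpa using hy)

namespace Simplify

theorem head {x y v w : List Slice} {c d : ℕ} (h : Shrink x c y) (h' : Simplify (y ++ v) d w) :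
    Simplify (x ++ v) (c + d) w := by
  simpa using (shrink [] v h).trans h'

theorem head_isotopy {x y v w : List Slice} {c : ℕ} (h : Shrink x 0 y)
    (h' : Simplify (y ++ v) c w) : Simplify (x ++ v) c w := by
  simpa using head h h'

theorem cons (s : Slice) {w w' : List Slice} {c : ℕ} (h : Simplify w c w') :
    Simplify (s :: w) c (s :: w') := by
  induction h with
  | refl w => exact refl _
  | trans _ _ h h' => exact h.trans h'
  | shrink u v h => exact shrink (s :: u) v h

theorem isDiagram {w w' : List Slice} {c n : ℕ} (h : Simplify w c w') (hw : IsDiagram n w) :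
    IsDiagram n w' := by
  induction h with
  | refl w => exact hw
  | trans _ _ h h' => exact h' (h hw)
  | shrink u v h => exact h.isDiagram hw

theorem bracket_eq {R : Type*} [CommRing R] {A : Rˣ} {w w' : List Slice} {c n : ℕ}
    (h : Simplify w c w') (hw : IsDiagram n w) :
    bracket R A n w = circleValue R A ^ c • bracket R A n w' := by
  induction h with
  | refl w => simp
  | trans h _ ih ih' => rw [ih hw, ih' (h.isDiagram hw), smul_smul, pow_add]
  | shrink u v h => exact h.bracket_eq hw

end Simplify

/-- The reflection of an event in a vertical line, up to a change of crossing. -/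
def Kind.mirror : Kind → Kind
  | .cup => .cap
  | .cap => .cup
  | .cross f => .cross f
  | .puncture => .puncture

/-- The reflection of a word of events in a vertical line, up to changes of crossings: crossings
keep their type, which is enough because `mirror` is only used to transport simplifications. -/
def mirror (w : List Slice) : List Slice := (w.map fun s => ⟨s.kind.mirror, s.pos⟩).reverse

theorem Kind.mirror_mirror (k : Kind) : k.mirror.mirror = k := by cases k <;> rfl

theorem mirror_mirror (w : List Slice) : mirror (mirror w) = w := by
  simp [mirror, Function.comp_def, Kind.mirror_mirror]

theorem mirror_append (u v : List Slice) : mirror (u ++ v) = mirror v ++ mirror u := by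
  simp [mirror]

theorem Kind.ins_mirror (k : Kind) : k.mirror.ins = k.outs := by cases k <;> rfl

theorem Kind.outs_mirror (k : Kind) : k.mirror.outs = k.ins := by cases k <;> rfl

theorem Kind.mirror_eq_puncture {k : Kind} : k.mirror = .puncture ↔ k = .puncture := by
  cases k <;> simp [Kind.mirror]

theorem Shrink.mirror {x y : List Slice} {c : ℕ} (h : Shrink x c y) :
    Shrink (mirror x) c (mirror y) := by
  cases h with
  | exchange g h i d hgh =>
    simpa [Skein.mirror, Kind.ins_mirror, Kind.outs_mirror] using
      Shrink.exchange' g.mirror h.mirror i d (by simpa [Kind.mirror_eq_puncture] using hgh)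
  | exchange' g h i d hgh =>
    simpa [Skein.mirror, Kind.ins_mirror, Kind.outs_mirror] using
      Shrink.exchange g.mirror h.mirror i d (by simpa [Kind.mirror_eq_puncture] using hgh)
  | zigzag i => exact .zigzag' i
  | zigzag' i => exact .zigzag i
  | cancel f i =>
    have := Shrink.cancel (!f) i
    rwa [Bool.not_not] at this
  | circle i => exact .circle i

theorem Simplify.mirror {w w' : List Slice} {c : ℕ} (h : Simplify w c w') :
    Simplify (mirror w) c (mirror w') := by
  induction h with
  | refl w => exact .refl _
  | trans _ _ h h' => exact h.trans h'
  | shrink u v h =>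
    simpa only [mirror_append, List.append_assoc] using
      Simplify.shrink (Skein.mirror v) (Skein.mirror u) h.mirror

/-- Move a cup at height `i` to the right through the word until it is absorbed by a cap or meets an
event that it cannot pass. Returned are the number of circles split off and the new word. -/
def pushCup : ℕ → List Slice → ℕ × List Slice
  | i, [] => (0, [cup i])
  | i, s :: v =>
    if s.pos + s.kind.ins ≤ i then (pushCup (i - s.kind.ins + s.kind.outs) v).map id (s :: ·)
    else if i + 2 ≤ s.pos then (pushCup i v).map id (⟨s.kind, s.pos - 2⟩ :: ·)
    else if s = cap i then (1, v)
    else if s = cap (i + 1) ∨ s.kind = .cap ∧ s.pos + 1 = i then (0, v)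
    else (0, cup i :: s :: v)

theorem simplify_pushCup (i : ℕ) (v : List Slice) :
    Simplify (cup i :: v) (pushCup i v).1 (pushCup i v).2 := by
  induction v generalizing i with
  | nil => exact .refl _
  | cons s v ih =>
    obtain ⟨k, p⟩ := s
    simp only [pushCup]
    split_ifs with below above circle zigzag
    · obtain ⟨d, rfl⟩ := Nat.exists_eq_add_of_le below
      rw [show p + k.ins + d - k.ins + k.outs = p + k.outs + d by omega]
      exact .head_isotopy (.exchange' k .cup p d (by simp)) ((ih _).cons _)
    · obtain ⟨d, rfl⟩ := Nat.exists_eq_add_of_le above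
      rw [show i + 2 + d - 2 = i + d by omega]
      exact .head_isotopy (.exchange .cup k i d (by simp)) ((ih i).cons _)
    · rw [circle]
      exact .head (.circle i) (.refl v)
    · obtain h | ⟨rfl, rfl⟩ := zigzag
      · rw [h]
        exact .head_isotopy (.zigzag i) (.refl v)
      · exact .head_isotopy (.zigzag' p) (.refl v)
    · exact .refl _

/-- Apply `pushCup` to all cups of a word, beginning with the last one. -/
def pushCups : List Slice → ℕ × List Slice
  | [] => (0, [])
  | s :: w =>
    let r := pushCups w
    if s.kind = .cup then (pushCup s.pos r.2).map (r.1 + ·) id else r.map id (s :: ·)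

theorem simplify_pushCups (w : List Slice) : Simplify w (pushCups w).1 (pushCups w).2 := by
  induction w with
  | nil => exact .refl _
  | cons s w ih =>
    obtain ⟨k, p⟩ := s
    simp only [pushCups]
    split_ifs with hk
    · subst hk
      exact (ih.cons _).trans (simplify_pushCup p _)
    · exact ih.cons _

/-- Push the cups of a word to the right and its caps to the left, `rounds` times. Returned are the
number of circles split off and the new word. -/
def tighten : (rounds : ℕ) → List Slice → ℕ × List Slice
  | 0, w => (0, w)
  | rounds + 1, w =>
    let r := pushCups w
    let r' := pushCups (mirror r.2)
    (tighten rounds (mirror r'.2)).map (r.1 + r'.1 + ·) id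

theorem simplify_tighten (rounds : ℕ) (w : List Slice) :
    Simplify w (tighten rounds w).1 (tighten rounds w).2 := by
  induction rounds generalizing w with
  | zero => exact .refl _
  | succ rounds ih =>
    have caps := (simplify_pushCups (mirror (pushCups w).2)).mirror
    rw [mirror_mirror] at caps
    exact ((simplify_pushCups w).trans caps).trans (ih _)

/-- Cancel adjacent inverse crossings. -/
def cancelCrossings : List Slice → List Slice
  | [] => []
  | s :: w =>
    match s.kind, cancelCrossings w with
    | .cross f, s' :: v => if s' = cross (!f) s.pos then v else s :: s' :: v
    | _, v => s :: v

theorem simplify_cancelCrossings (w : List Slice) : Simplify w 0 (cancelCrossings w) := by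
  induction w with
  | nil => exact .refl _
  | cons s w ih =>
    obtain ⟨k, p⟩ := s
    have h := ih.cons ⟨k, p⟩
    simp only [cancelCrossings]
    split
    · rename_i f s' v hv
      rw [hv] at h
      split_ifs with inverse
      · rw [inverse] at h
        exact h.trans (.head_isotopy (.cancel f p) (.refl v))
      · exact h
    · exact h

/-! ### Superposition of words -/

theorem superposed_upper {m k : ℕ} {s : Slice} {w₁ w₂ w : List Slice} (hs : s.kind ≠ .puncture)
    (hk : s.pos + s.kind.ins ≤ k)
    (h : Superposed (.replicate m false ++ .replicate (k - s.kind.ins + s.kind.outs) true)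
      w₁ w₂ w) :
    Superposed (.replicate m false ++ .replicate k true) (s :: w₁) w₂
      (⟨s.kind, m + s.pos⟩ :: w) := by
  obtain ⟨d, rfl⟩ := Nat.exists_eq_add_of_le hk
  have := Superposed.upper (.replicate m false ++ .replicate s.pos true) (.replicate d true) s.kind
    hs w₁ w₂ w (by
      rw [show s.pos + s.kind.ins + d - s.kind.ins + s.kind.outs = s.pos + s.kind.outs + d by omega]
        at h
      simpa [Nat.add_assoc] using h)
  simpa [List.count_replicate, Nat.add_assoc] using this

theorem superposed_lower {m k : ℕ} {s : Slice} {w₁ w₂ w : List Slice} (hs : s.kind ≠ .puncture)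
    (hm : s.pos + s.kind.ins ≤ m)
    (h : Superposed (.replicate (m - s.kind.ins + s.kind.outs) false ++ .replicate k true)
      w₁ w₂ w) :
    Superposed (.replicate m false ++ .replicate k true) w₁ (s :: w₂) (s :: w) := by
  obtain ⟨d, rfl⟩ := Nat.exists_eq_add_of_le hm
  have := Superposed.lower (.replicate s.pos false) (.replicate d false ++ .replicate k true) s.kind
    hs w₁ w₂ w (by
      rw [show s.pos + s.kind.ins + d - s.kind.ins + s.kind.outs = s.pos + s.kind.outs + d by omega]
        at h
      simpa [Nat.add_assoc, ← List.append_assoc] using h)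
  simpa [List.count_replicate, Nat.add_assoc, ← List.append_assoc] using this

theorem superposed_append_lower {m : ℕ} {u v w₁ w : List Slice} (hu : Fits m u)
    (h : Superposed (.replicate (width m u) false) w₁ v w) :
    Superposed (.replicate m false) (.replicate (punctureCount u) (puncture 0) ++ w₁) (u ++ v)
      (u ++ w) := by
  induction u generalizing m with
  | nil => exact h
  | cons s u ih =>
    obtain ⟨hs, hu⟩ := hu
    have ih := ih hu h
    by_cases hk : s.kind = .puncture
    · obtain ⟨_, p⟩ := s
      subst hk
      obtain ⟨d, rfl⟩ := Nat.exists_eq_add_of_le hs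
      simpa [punctureCount_cons, puncture, Kind.ins, Nat.add_comm 1, List.replicate_succ,
          List.count_replicate] using
        Superposed.puncture (.replicate p false) (.replicate d false) _ _ _
          (by simpa [puncture, Kind.ins, Kind.outs] using ih)
    · simpa [punctureCount_cons, hk] using
        superposed_lower (k := 0) hk hs (by simpa using ih)

theorem superposed_append_upper {k : ℕ} {u v w₂ w : List Slice} (hu : Fits k u)
    (h : Superposed (.replicate (width k u) true) v w₂ w) :
    Superposed (.replicate k true) (u ++ v) (.replicate (punctureCount u) (puncture 0) ++ w₂)
      (u ++ w) := by
  induction u generalizing k with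
  | nil => exact h
  | cons s u ih =>
    obtain ⟨hs, hu⟩ := hu
    have ih := ih hu h
    by_cases hk : s.kind = .puncture
    · obtain ⟨_, p⟩ := s
      subst hk
      obtain ⟨d, rfl⟩ := Nat.exists_eq_add_of_le hs
      simpa [punctureCount_cons, puncture, Kind.ins, Nat.add_comm 1, List.replicate_succ,
          List.count_replicate] using
        Superposed.puncture (.replicate p true) (.replicate d true) _ _ _
          (by simpa [puncture, Kind.ins, Kind.outs] using ih)
    · simpa [punctureCount_cons, hk] using
        superposed_upper (m := 0) hk hs (by simpa using ih)

/-- `Weave c l c'`: crossings at the heights `l`, at each of which a strand of the upper link moves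
down past a strand of the lower link, lead from the strands `c` to the strands `c'`. As in
`Superposed`, the strands of the upper link are those marked `true`. -/
inductive Weave : List Bool → List ℕ → List Bool → Prop
  | refl (c : List Bool) : Weave c [] c
  | cross (a b c : List Bool) (l : List ℕ) : Weave (a ++ [true, false] ++ b) l c →
      Weave (a ++ [false, true] ++ b) (a.length :: l) c

theorem Weave.trans {c c' c'' : List Bool} {l l' : List ℕ} (h : Weave c l c')
    (h' : Weave c' l' c'') : Weave c (l ++ l') c'' := by
  induction h with
  | refl c => exact h'
  | cross a b c l _ ih => exact .cross a b c'' _ (ih h')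

theorem Weave.superposed {c c' : List Bool} {l : List ℕ} (h : Weave c l c') {w₁ w₂ w : List Slice}
    (hw : Superposed c' w₁ w₂ w) : Superposed c w₁ w₂ (l.map (Skein.cross false) ++ w) := by
  induction h with
  | refl c => exact hw
  | cross a b c l _ ih => exact .lowerRises a b w₁ w₂ _ (ih hw)

theorem Weave.superposed_reverse {c c' : List Bool} {l : List ℕ} (h : Weave c l c')
    {w₁ w₂ w : List Slice} (hw : Superposed c w₁ w₂ w) :
    Superposed c' w₁ w₂ (l.reverse.map (Skein.cross true) ++ w) := by
  induction h generalizing w with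
  | refl c => exact hw
  | cross a b c l _ ih => simpa using ih (.upperRises a b w₁ w₂ w hw)

/-- The heights of the crossings by which one upper strand moves down past `d` lower strands at the
heights `p, …, p + d - 1`. -/
def strandOver (p : ℕ) : (d : ℕ) → List ℕ
  | 0 => []
  | d + 1 => (p + d) :: strandOver p d

/-- The heights of the crossings by which `r` upper strands move down past `d` lower strands at the
heights `p, …, p + d - 1`. -/
def strandsOver (p d : ℕ) : (r : ℕ) → List ℕ
  | 0 => []
  | r + 1 => strandOver p d ++ strandsOver (p + 1) d r

theorem weave_strandOver (a b : List Bool) (d : ℕ) :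
    Weave (a ++ .replicate d false ++ true :: b) (strandOver a.length d)
      (a ++ true :: .replicate d false ++ b) := by
  induction d generalizing b with
  | zero => simpa [strandOver] using Weave.refl (a ++ true :: b)
  | succ d ih =>
    have := Weave.cross (a ++ .replicate d false) b _ _ (by simpa using ih (false :: b))
    simpa [strandOver, List.replicate_succ'] using this

theorem weave_strandsOver (a b : List Bool) (d r : ℕ) :
    Weave (a ++ .replicate d false ++ .replicate r true ++ b) (strandsOver a.length d r)
      (a ++ .replicate r true ++ .replicate d false ++ b) := by
  induction r generalizing a with
  | zero => simpa [strandsOver] using Weave.refl (a ++ .replicate d false ++ b)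
  | succ r ih =>
    have first := weave_strandOver a (.replicate r true ++ b) d
    have others := ih (a ++ [true])
    simp only [List.length_append, List.length_singleton, List.append_assoc, List.singleton_append]
      at others
    simpa [strandsOver, List.replicate_succ] using first.trans (by simpa using others)

/-- The word `w₁` drawn above the word `w₂`: at the punctures, the strands of `w₁` that pass below
the puncture are moved down past the strands of `w₂` that pass above it, and back afterwards;
elsewhere the `m` strands of `w₂` run below those of `w₁`. -/
def stack : (m : ℕ) → (w₁ w₂ : List Slice) → List Slice
  | _, [], w₂ => w₂
  | _, s₁ :: w₁, [] => s₁ :: w₁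
  | m, s₁ :: w₁, s₂ :: w₂ =>
    if s₁.kind ≠ .puncture then ⟨s₁.kind, m + s₁.pos⟩ :: stack m w₁ (s₂ :: w₂)
    else if s₂.kind ≠ .puncture then
      s₂ :: stack (m - s₂.kind.ins + s₂.kind.outs) (s₁ :: w₁) w₂
    else
      let l := strandsOver s₂.pos (m - s₂.pos) s₁.pos
      l.map (cross false) ++ puncture (s₂.pos + s₁.pos) ::
        (l.reverse.map (cross true) ++ stack m w₁ w₂)
  termination_by _ w₁ w₂ => w₁.length + w₂.length

theorem superposed_puncture {m k p₁ p₂ : ℕ} {w₁ w₂ w : List Slice} (h₁ : p₁ ≤ k) (h₂ : p₂ ≤ m)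
    (h : Superposed (.replicate m false ++ .replicate k true) w₁ w₂ w) :
    Superposed (.replicate m false ++ .replicate k true) (puncture p₁ :: w₁) (puncture p₂ :: w₂)
      ((strandsOver p₂ (m - p₂) p₁).map (cross false) ++ puncture (p₂ + p₁) ::
        ((strandsOver p₂ (m - p₂) p₁).reverse.map (cross true) ++ w)) := by
  obtain ⟨d₁, rfl⟩ := Nat.exists_eq_add_of_le h₁
  obtain ⟨d₂, rfl⟩ := Nat.exists_eq_add_of_le h₂
  have hweave := weave_strandsOver (.replicate p₂ false) (.replicate d₁ true) d₂ p₁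
  simp only [List.length_replicate] at hweave
  rw [Nat.add_sub_cancel_left]
  simp only [List.replicate_add, ← List.append_assoc] at h ⊢
  have := Superposed.puncture (.replicate p₂ false ++ .replicate p₁ true)
    (.replicate d₂ false ++ .replicate d₁ true) w₁ w₂ _
    (by simpa only [← List.append_assoc] using hweave.superposed_reverse h)
  simpa using hweave.superposed (by simpa [List.count_replicate] using this)

theorem superposed_stack {m k : ℕ} {w₁ w₂ : List Slice} (h₁ : Closes k w₁) (h₂ : Closes m w₂)
    (hp : punctureCount w₁ = punctureCount w₂) :
    Superposed (.replicate m false ++ .replicate k true) w₁ w₂ (stack m w₁ w₂) := by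
  induction m, w₁, w₂ using stack.induct generalizing k with
  | case1 m w₂ =>
    obtain rfl : k = 0 := h₁
    rw [← List.append_nil w₂, closes_append] at h₂
    have := superposed_append_lower h₂.1 (w₁ := []) (v := []) (w := []) (by
      rw [show width m w₂ = 0 from h₂.2]; exact .nil)
    rw [← hp] at this
    simpa [stack] using this
  | case2 m s₁ w₁ =>
    obtain rfl : m = 0 := h₂
    rw [← List.append_nil (s₁ :: w₁), closes_append] at h₁
    have := superposed_append_upper h₁.1 (w₂ := []) (v := []) (w := []) (by
      rw [show width k (s₁ :: w₁) = 0 from h₁.2]; exact .nil)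
    rw [hp] at this
    simpa [stack] using this
  | case3 m s₁ w₁ s₂ w₂ hs₁ ih =>
    rw [stack, if_pos hs₁]
    exact superposed_upper hs₁ h₁.1 (ih h₁.2 h₂ (by simpa [punctureCount_cons, hs₁] using hp))
  | case4 m s₁ w₁ s₂ w₂ hs₁ hs₂ ih =>
    rw [stack, if_neg hs₁, if_pos hs₂]
    exact superposed_lower hs₂ h₂.1 (ih h₁ h₂.2 (by simpa [punctureCount_cons, hs₂] using hp))
  | case5 m s₁ w₁ s₂ w₂ hs₁ hs₂ ih =>
    rw [stack, if_neg hs₁, if_neg hs₂]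
    obtain ⟨k₁, p₁⟩ := s₁
    obtain ⟨k₂, p₂⟩ := s₂
    obtain rfl : k₁ = .puncture := not_not.1 hs₁
    obtain rfl : k₂ = .puncture := not_not.1 hs₂
    exact superposed_puncture h₁.1 h₂.1
      (ih h₁.2 h₂.2 (by simpa [punctureCount_cons] using hp))

theorem superposed_stack_of_isDiagram {n : ℕ} {w₁ w₂ : List Slice} (h₁ : IsDiagram n w₁)
    (h₂ : IsDiagram n w₂) : Superposed [] w₁ w₂ (stack 0 w₁ w₂) :=
  superposed_stack h₁.closes h₂.closes (h₁.punctures.trans h₂.punctures.symm)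

/-! ### A normal form for polynomials in the curves -/

/-- The term `coeff • A ^ degree • atom` of a formal linear combination. -/
structure Term (ι : Type) : Type where
  coeff : ℤ
  degree : ℤ
  atom : ι

/-- Formal linear combinations of elements of `ι`, whose coefficients are Laurent polynomials in `A`
with integer coefficients. -/
abbrev Combination (ι : Type) : Type := List (Term ι)

namespace Combination

variable {ι κ : Type}

/-- Replace each atom of a combination by a combination. -/
def bind (T : Combination ι) (φ : ι → Combination κ) : Combination κ :=
  T.flatMap fun x => (φ x.atom).map fun y => ⟨x.coeff * y.coeff, x.degree + y.degree, y.atom⟩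

/-- Add a term to a combination, merging it with a term of the same degree and atom. -/
def addTerm [DecidableEq ι] (x : Term ι) : Combination ι → Combination ι
  | [] => [x]
  | y :: T =>
    if x.atom = y.atom ∧ x.degree = y.degree then ⟨x.coeff + y.coeff, y.degree, y.atom⟩ :: T
    else y :: addTerm x T

/-- Merge the terms of equal degree and atom. -/
def collect [DecidableEq ι] (T : Combination ι) : Combination ι := T.foldr addTerm []

section Eval

variable {R S : Type*} [CommRing R] [AddCommGroup S] [Module R S] (A : Rˣ)

/-- The value of a combination in an `R`-module, given the values of the atoms. -/
def eval (f : ι → S) (T : Combination ι) : S :=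
  (T.map fun x => ((x.coeff : R) * ((A ^ x.degree : Rˣ) : R)) • f x.atom).sum

@[simp] theorem eval_nil (f : ι → S) : eval A f [] = 0 := rfl

@[simp] theorem eval_cons (f : ι → S) (x : Term ι) (T : Combination ι) :
    eval A f (x :: T) = ((x.coeff : R) * ((A ^ x.degree : Rˣ) : R)) • f x.atom + eval A f T := by
  simp [eval]

@[simp] theorem eval_append (f : ι → S) (T U : Combination ι) :
    eval A f (T ++ U) = eval A f T + eval A f U := by
  simp [eval]

theorem eval_shift (f : ι → S) (k d : ℤ) (T : Combination ι) :
    eval A f (T.map fun y => ⟨k * y.coeff, d + y.degree, y.atom⟩) =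
      ((k : R) * ((A ^ d : Rˣ) : R)) • eval A f T := by
  induction T with
  | nil => simp
  | cons y T ih =>
    rw [List.map_cons, eval_cons, ih, eval_cons, smul_add, smul_smul]
    congr 2
    push_cast [zpow_add]
    ring

theorem eval_bind {f : ι → S} {g : κ → S} {φ : ι → Combination κ} {T : Combination ι}
    (h : ∀ x ∈ T, eval A g (φ x.atom) = f x.atom) : eval A g (T.bind φ) = eval A f T := by
  induction T with
  | nil => rfl
  | cons x T ih =>
    obtain ⟨hx, hT⟩ := List.forall_mem_cons.1 h
    rw [bind, List.flatMap_cons, eval_append, eval_shift, hx, eval_cons]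
    exact congrArg _ (ih hT)

theorem eval_addTerm [DecidableEq ι] (f : ι → S) (x : Term ι) (T : Combination ι) :
    eval A f (addTerm x T) = eval A f (x :: T) := by
  induction T with
  | nil => rfl
  | cons y T ih =>
    rw [addTerm]
    split_ifs with h
    · simp only [eval_cons, h.1, h.2, Int.cast_add, add_mul, add_smul, add_assoc]
    · rw [eval_cons, ih, eval_cons, eval_cons, eval_cons, add_left_comm]

theorem eval_collect [DecidableEq ι] (f : ι → S) (T : Combination ι) :
    eval A f (collect T) = eval A f T := by
  induction T with
  | nil => rfl
  | cons x T ih => exact (eval_addTerm A f x _).trans (by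
    rw [eval_cons, eval_cons, ← ih, collect])

theorem eval_mul_left {S : Type*} [Ring S] [Algebra R S] (f : ι → S) (a : S) (T : Combination ι) :
    eval A (fun i => a * f i) T = a * eval A f T := by
  simp only [eval, ← mul_smul_comm, List.sum_map_mul_left]

theorem eval_eq_zero (f : ι → S) {T : Combination ι} (h : ∀ x ∈ T, x.coeff = 0) :
    eval A f T = 0 :=
  List.sum_eq_zero (by simpa using fun x hx => by simp [h x hx])

end Eval

theorem mem_bind {T : Combination ι} {φ : ι → Combination κ} {y : Term κ} (h : y ∈ T.bind φ) :
    ∃ x ∈ T, ∃ z ∈ φ x.atom, z.atom = y.atom := by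
  obtain ⟨x, hx, hy⟩ := List.mem_flatMap.1 h
  obtain ⟨z, hz, rfl⟩ := List.mem_map.1 hy
  exact ⟨x, hx, z, hz, rfl⟩

end Combination

/-- The two smoothings of a crossing `s` followed by the word `v`; for other events `s` the word
`s :: v` itself. -/
def smoothings (s : Slice) (v : List Slice) : Combination (List Slice) :=
  match s.kind with
  | .cross f => [⟨1, if f then 1 else -1, cap s.pos :: cup s.pos :: v⟩, ⟨1, if f then -1 else 1, v⟩]
  | _ => [⟨1, 0, s :: v⟩]

/-- The expansion of a word obtained by smoothing all its crossings. -/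
def resolve : List Slice → Combination (List Slice)
  | [] => [⟨1, 0, []⟩]
  | s :: w => (resolve w).bind (smoothings s)

/-- The expansion of the union of `c` trivial circles and a word. -/
def circles : (c : ℕ) → List Slice → Combination (List Slice)
  | 0, w => [⟨1, 0, w⟩]
  | c + 1, w => Combination.bind [⟨-1, 2, w⟩, ⟨-1, -2, w⟩] (circles c)

/-- The expansion of a word in crossingless words without superfluous cups and caps. -/
def planar (w : List Slice) : Combination (List Slice) :=
  (resolve (cancelCrossings w)).bind fun v =>
    let r := tighten 2 v
    circles r.1 r.2

/-- The expansion of the product of the curves `t_I`, where `I` runs through a list. -/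
def monomial {n : ℕ} : List (Finset (Fin n)) → Combination (List Slice)
  | [] => [⟨1, 0, .replicate n (puncture 0)⟩]
  | I :: l => (monomial l).bind fun w => planar (stack 0 (curve I).word w)

/-- Whether the expansion of a noncommutative polynomial in the curves `t_I` is identically zero. -/
def isZero {n : ℕ} (T : Combination (List (Finset (Fin n)))) : Bool :=
  (T.bind monomial).collect.all fun x => x.coeff = 0

theorem isDiagram_of_mem_smoothings {n : ℕ} {s : Slice} {u v : List Slice}
    (h : IsDiagram n (u ++ s :: v)) : ∀ x ∈ smoothings s v, IsDiagram n (u ++ x.atom) := by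
  obtain ⟨k, p⟩ := s
  cases k with
  | cross f => simpa [smoothings] using h.smoothing
  | cup | cap | puncture => simpa [smoothings] using h

theorem isDiagram_of_mem_resolve {n : ℕ} {u w : List Slice} (h : IsDiagram n (u ++ w)) :
    ∀ x ∈ resolve w, IsDiagram n (u ++ x.atom) := by
  induction w generalizing u with
  | nil => simpa [resolve] using h
  | cons s w ih =>
    intro y hy
    obtain ⟨x, hx, z, hz, hzy⟩ := Combination.mem_bind hy
    rw [List.append_cons] at h
    exact hzy ▸ isDiagram_of_mem_smoothings (by simpa using ih h x hx) z hz

theorem atom_of_mem_circles {c : ℕ} {w : List Slice} {x : Term (List Slice)}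
    (h : x ∈ circles c w) : x.atom = w := by
  induction c generalizing x with
  | zero => simp_all [circles]
  | succ c ih =>
    obtain ⟨y, hy, z, hz, hzx⟩ := Combination.mem_bind h
    have hy : y.atom = w := by
      obtain rfl | rfl := by simpa using hy
      all_goals rfl
    exact hzx ▸ ih (hy ▸ hz)

theorem isDiagram_of_mem_planar {n : ℕ} {w : List Slice} (h : IsDiagram n w) :
    ∀ x ∈ planar w, IsDiagram n x.atom := by
  intro y hy
  obtain ⟨x, hx, z, hz, hzy⟩ := Combination.mem_bind hy
  rw [← hzy, atom_of_mem_circles hz]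
  exact (simplify_tighten 2 x.atom).isDiagram
    (isDiagram_of_mem_resolve (u := []) ((simplify_cancelCrossings w).isDiagram h) x hx)

theorem isDiagram_of_mem_monomial {n : ℕ} (l : List (Finset (Fin n))) :
    ∀ x ∈ monomial l, IsDiagram n x.atom := by
  induction l with
  | nil => simpa [monomial] using isDiagram_replicate n
  | cons I l ih =>
    intro y hy
    obtain ⟨x, hx, z, hz, hzy⟩ := Combination.mem_bind hy
    have hs := superposed_stack_of_isDiagram (isDiagram_word (curve I)) (ih x hx)
    exact hzy ▸ isDiagram_of_mem_planar (hs.isDiagram (ih x hx)) z hz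

section Eval

variable {R : Type*} [CommRing R] {A : Rˣ} {n : ℕ}

theorem eval_smoothings {s : Slice} {u v : List Slice} (h : IsDiagram n (u ++ s :: v)) :
    (smoothings s v).eval A (fun w => bracket R A n (u ++ w)) = bracket R A n (u ++ s :: v) := by
  obtain ⟨k, p⟩ := s
  cases k with
  | cross f =>
    refine Eq.trans ?_ (bracket_cross (R := R) (A := A) h).symm
    simp [smoothings]
  | cup | cap | puncture => simp [smoothings]

theorem eval_resolve {u w : List Slice} (h : IsDiagram n (u ++ w)) :
    (resolve w).eval A (fun w => bracket R A n (u ++ w)) = bracket R A n (u ++ w) := by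
  induction w generalizing u with
  | nil => simp [resolve]
  | cons s w ih =>
    rw [List.append_cons] at h ⊢
    rw [resolve, Combination.eval_bind A (f := fun w => bracket R A n ((u ++ [s]) ++ w)), ih h]
    intro x hx
    have hx := isDiagram_of_mem_resolve h x hx
    rw [List.append_assoc] at hx ⊢
    exact eval_smoothings hx

theorem eval_circles (f : List Slice → SkeinAlgebra R A n) (c : ℕ) (w : List Slice) :
    (circles c w).eval A f = circleValue R A ^ c • f w := by
  induction c with
  | zero => simp [circles]
  | succ c ih =>
    rw [circles, Combination.eval_bind (f := fun w => circleValue R A ^ c • f w) A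
      (by simpa using ih), pow_succ', mul_smul, circleValue]
    simp only [Combination.eval_cons, Combination.eval_nil, add_zero, ← add_smul]
    congr 1
    simp [zpow_ofNat, add_comm]

theorem eval_planar {w : List Slice} (h : IsDiagram n w) :
    (planar w).eval A (bracket R A n) = bracket R A n w := by
  have hcancel := simplify_cancelCrossings w
  have hw := hcancel.isDiagram h
  rw [planar, Combination.eval_bind (f := bracket R A n) A, hcancel.bracket_eq h, pow_zero,
    one_smul]
  · exact eval_resolve (u := []) hw
  · intro x hx
    rw [eval_circles, (simplify_tighten 2 x.atom).bracket_eq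
      (isDiagram_of_mem_resolve (u := []) hw x hx)]

theorem eval_monomial (l : List (Finset (Fin n))) :
    (monomial l).eval A (bracket R A n) = (l.map (t A)).prod := by
  induction l with
  | nil => simp [monomial, bracket_replicate]
  | cons I l ih =>
    rw [List.map_cons, List.prod_cons, ← ih, ← Combination.eval_mul_left, monomial]
    refine Combination.eval_bind (f := fun w => t A I * bracket R A n w) A fun x hx => ?_
    have hI := isDiagram_word (curve I)
    have hx := isDiagram_of_mem_monomial l x hx
    have hstack := superposed_stack_of_isDiagram hI hx
    rw [eval_planar (hstack.isDiagram hx), ← bracket_curve, bracket_mul hI hx hstack]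

theorem eval_eq_zero_of_isZero {T : Combination (List (Finset (Fin n)))} (h : isZero T) :
    T.eval A (fun l => (l.map (t A)).prod) = 0 := by
  rw [← Combination.eval_bind A fun x _ => eval_monomial x.atom, ← Combination.eval_collect]
  exact Combination.eval_eq_zero A _ (by simpa [isZero] using h)

end Eval

/-! ### Inserting punctures -/

theorem Closes.unique {w : List Slice} {m m' : ℕ} (h : Closes m w) (h' : Closes m' w) :
    m = m' := by
  induction w generalizing m m' with
  | nil => exact h.trans h'.symm
  | cons s w ih =>
    obtain ⟨hs, hw⟩ := h
    obtain ⟨hs', hw'⟩ := h'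
    have := ih hw hw'
    omega

/-- Insert a puncture above all the strands, immediately after the `j`-th puncture of a word
starting with `m` strands. -/
def insertPuncture : (j m : ℕ) → List Slice → List Slice
  | 0, m, w => puncture m :: w
  | _ + 1, m, [] => [puncture m]
  | j + 1, m, s :: w =>
    s :: insertPuncture (if s.kind = .puncture then j else j + 1) (m - s.kind.ins + s.kind.outs) w

@[simp] theorem insertPuncture_zero (m : ℕ) (w : List Slice) :
    insertPuncture 0 m w = puncture m :: w := by
  cases w <;> rfl

theorem closes_insertPuncture {j m : ℕ} {w : List Slice} (h : Closes m w) :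
    Closes m (insertPuncture j m w) := by
  induction w generalizing j m with
  | nil => cases j <;> simpa [insertPuncture, Closes, puncture, Kind.ins, Kind.outs] using h
  | cons s w ih =>
    cases j with
    | zero => exact ⟨le_rfl, h⟩
    | succ j => exact ⟨h.1, ih h.2⟩

theorem punctureCount_insertPuncture (j m : ℕ) (w : List Slice) :
    punctureCount (insertPuncture j m w) = punctureCount w + 1 := by
  induction w generalizing j m with
  | nil => cases j <;> rfl
  | cons s w ih =>
    cases j with
    | zero => simp [punctureCount_cons, puncture, add_comm]
    | succ j => simp [insertPuncture, punctureCount_cons, ih, add_assoc]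

theorem IsDiagram.insertPuncture {n : ℕ} {w : List Slice} (h : IsDiagram n w) (j : ℕ) :
    IsDiagram (n + 1) (insertPuncture j 0 w) :=
  ⟨closes_insertPuncture h.closes, by rw [punctureCount_insertPuncture, h.punctures]⟩

theorem insertPuncture_replicate (j n : ℕ) :
    insertPuncture j 0 (List.replicate n (puncture 0)) = List.replicate (n + 1) (puncture 0) := by
  induction n generalizing j with
  | zero => cases j <;> rfl
  | succ n ih =>
    cases j with
    | zero => rfl
    | succ j => exact congrArg _ (ih j)

theorem simplify_insertPuncture {m : ℕ} {u v : List Slice} (h : Closes m (u ++ v)) :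
    Simplify (insertPuncture (punctureCount u) m (u ++ v)) 0
      (u ++ puncture (width m u) :: v) := by
  induction u generalizing m with
  | nil => exact insertPuncture_zero m v ▸ .refl _
  | cons s u ih =>
    have ih := ih h.2
    rw [punctureCount_cons]
    by_cases hs : s.kind = .puncture
    · rw [if_pos hs, add_comm, List.cons_append, insertPuncture, if_pos hs]
      exact ih.cons s
    rw [if_neg hs, zero_add]
    cases hj : punctureCount u with
    | zero =>
      obtain ⟨d, rfl⟩ := Nat.exists_eq_add_of_le h.1
      refine .head_isotopy (.exchange' s.kind .puncture s.pos d (by simp [hs])) (.cons s ?_)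
      rw [hj, insertPuncture_zero] at ih
      rw [show s.pos + s.kind.outs + d = s.pos + s.kind.ins + d - s.kind.ins + s.kind.outs by omega]
      exact ih
    | succ j =>
      rw [List.cons_append, insertPuncture, if_neg hs, ← hj]
      exact ih.cons s

theorem exists_split {j : ℕ} {w : List Slice} (h : j ≤ punctureCount w) :
    ∃ u v, w = u ++ v ∧ punctureCount u = j := by
  induction w generalizing j with
  | nil => exact ⟨[], [], rfl, (Nat.le_zero.1 h).symm⟩
  | cons s w ih =>
    rw [punctureCount_cons] at h
    rcases j.eq_zero_or_pos with rfl | hj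
    · exact ⟨[], _, rfl, rfl⟩
    · obtain ⟨u, v, rfl, hu⟩ := ih (j := j - if s.kind = .puncture then 1 else 0) (by omega)
      refine ⟨s :: u, v, rfl, ?_⟩
      rw [punctureCount_cons, hu]
      split_ifs <;> omega

theorem Superposed.insertPuncture_zero {c : List Bool} {w₁ w₂ w : List Slice}
    (h : Superposed c w₁ w₂ w) :
    Superposed c (insertPuncture 0 (c.count true) w₁) (insertPuncture 0 (c.count false) w₂)
      (insertPuncture 0 c.length w) := by
  simpa only [Skein.insertPuncture_zero, List.append_nil] using
    Superposed.puncture c [] w₁ w₂ w (by rwa [List.append_nil])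

theorem Superposed.insertPuncture {c : List Bool} {w₁ w₂ w : List Slice}
    (h : Superposed c w₁ w₂ w) (j : ℕ) :
    Superposed c (insertPuncture j (c.count true) w₁) (insertPuncture j (c.count false) w₂)
      (insertPuncture j c.length w) := by
  obtain rfl | hj := eq_or_ne j 0
  · exact h.insertPuncture_zero
  obtain ⟨j, rfl⟩ := Nat.exists_eq_succ_of_ne_zero hj
  clear hj
  induction h generalizing j with
  | nil => exact .puncture [] [] _ _ _ .nil
  | upper a b k hk _ _ _ _ ih =>
    simp only [Skein.insertPuncture, if_neg hk]
    refine .upper a b k hk _ _ _ ?_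
    convert ih j using 2 <;> grind
  | lower a b k hk _ _ _ _ ih =>
    simp only [Skein.insertPuncture, if_neg hk]
    refine .lower a b k hk _ _ _ ?_
    convert ih j using 2 <;> grind
  | puncture a b w₁ w₂ w h ih =>
    cases j with
    | zero => exact .puncture a b _ _ _ h.insertPuncture_zero
    | succ j => exact .puncture a b _ _ _ (ih j)
  | upperRises a b _ _ _ _ ih =>
    refine .upperRises a b _ _ _ ?_
    convert ih j using 2 <;> grind [cross, Kind.ins, Kind.outs]
  | lowerRises a b _ _ _ _ ih =>
    refine .lowerRises a b _ _ _ ?_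
    convert ih j using 2 <;> grind [cross, Kind.ins, Kind.outs]

section Bracket

variable {R : Type*} [CommRing R] {A : Rˣ} {n j : ℕ}

theorem bracket_insertPuncture {u v : List Slice} (h : IsDiagram n (u ++ v)) :
    IsDiagram (n + 1) (u ++ puncture (width 0 u) :: v) ∧
      bracket R A (n + 1) (insertPuncture (punctureCount u) 0 (u ++ v)) =
        bracket R A (n + 1) (u ++ puncture (width 0 u) :: v) := by
  have hs := simplify_insertPuncture h.closes
  have hc := h.insertPuncture (punctureCount u)
  exact ⟨hs.isDiagram hc, by rw [hs.bracket_eq hc, pow_zero, one_smul]⟩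

variable (R A) in
theorem exists_context {u v x : List Slice} (hx : IsDiagram n (u ++ x ++ v))
    (hp : punctureCount x ≤ 1) (hj : j ≤ n) :
    ∃ u' v', ∀ y, IsDiagram n (u ++ y ++ v) → IsDiagram (n + 1) (u' ++ y ++ v') ∧
      bracket R A (n + 1) (insertPuncture j 0 (u ++ y ++ v)) =
        bracket R A (n + 1) (u' ++ y ++ v') := by
  have hn := hx.punctures
  simp only [punctureCount_append] at hn
  by_cases h : j ≤ punctureCount u
  · obtain ⟨u₁, u₂, rfl, rfl⟩ := exists_split h
    refine ⟨u₁ ++ puncture (width 0 u₁) :: u₂, v, fun y hy => ?_⟩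
    simp only [List.append_assoc, List.cons_append] at hy ⊢
    exact bracket_insertPuncture hy
  · obtain ⟨v₁, v₂, rfl, hv⟩ := exists_split (j := j - punctureCount (u ++ x)) (w := v)
      (by simp only [punctureCount_append]; omega)
    refine ⟨u, v₁ ++ puncture (width 0 (u ++ x ++ v₁)) :: v₂, fun y hy => ?_⟩
    have hwidth : width 0 (u ++ x ++ v₁) = width 0 (u ++ y ++ v₁) := by
      have hx := hx.closes
      have hy := hy.closes
      rw [← List.append_assoc, closes_append] at hx hy
      exact hx.2.unique hy.2
    obtain rfl : j = punctureCount (u ++ y ++ v₁) := by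
      have := hy.punctures
      simp only [punctureCount_append] at this hv hn ⊢
      omega
    rw [hwidth]
    rw [← List.append_assoc] at hy ⊢
    simpa only [List.append_assoc] using bracket_insertPuncture (R := R) (A := A) hy

theorem bracket_insertPuncture_localMove {u v x y : List Slice} (hxy : LocalMove x y)
    (hx : IsDiagram n (u ++ x ++ v)) (hy : IsDiagram n (u ++ y ++ v)) (hj : j ≤ n) :
    bracket R A (n + 1) (insertPuncture j 0 (u ++ x ++ v)) =
      bracket R A (n + 1) (insertPuncture j 0 (u ++ y ++ v)) := by
  obtain ⟨u', v', h⟩ := exists_context R A hx hxy.punctureCount_le_one hj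
  obtain ⟨hx, hbx⟩ := h x hx
  obtain ⟨hy, hby⟩ := h y hy
  rw [hbx, hby, bracket_localMove hxy hx hy]

theorem bracket_insertPuncture_cross {i : ℕ} {f : Bool} {u v : List Slice}
    (h : IsDiagram n (u ++ [cross f i] ++ v)) (hj : j ≤ n) :
    bracket R A (n + 1) (insertPuncture j 0 (u ++ [cross f i] ++ v)) =
      ((A ^ (if f then 1 else -1 : ℤ) : Rˣ) : R) •
        bracket R A (n + 1) (insertPuncture j 0 (u ++ [cap i, cup i] ++ v)) +
      ((A ^ (if f then -1 else 1 : ℤ) : Rˣ) : R) •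
        bracket R A (n + 1) (insertPuncture j 0 (u ++ v)) := by
  obtain ⟨u', v', hins⟩ := exists_context R A h zero_le_one hj
  have hsmooth := IsDiagram.smoothing (by simpa using h)
  obtain ⟨hcross, hbcross⟩ := hins _ h
  have h₁ := (hins [cap i, cup i] (by simpa using hsmooth.1)).2
  have h₂ := (hins [] (by simpa using hsmooth.2)).2
  simp only [List.append_assoc, List.cons_append, List.nil_append] at hcross hbcross h₁ h₂ ⊢
  rw [hbcross, h₁, h₂, bracket_cross hcross]

theorem bracket_insertPuncture_circle {i : ℕ} {u v : List Slice}
    (h : IsDiagram n (u ++ [cup i, cap i] ++ v)) (h' : IsDiagram n (u ++ v)) (hj : j ≤ n) :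
    bracket R A (n + 1) (insertPuncture j 0 (u ++ [cup i, cap i] ++ v)) =
      circleValue R A • bracket R A (n + 1) (insertPuncture j 0 (u ++ v)) := by
  obtain ⟨u', v', hins⟩ := exists_context R A h zero_le_one hj
  obtain ⟨h, hb⟩ := hins _ h
  obtain ⟨h', hb'⟩ := hins [] (by simpa using h')
  simp only [List.append_nil] at h' hb'
  rw [hb, hb', bracket_circle h h']

theorem insertPuncture_rel (hj : j ≤ n) {x y : FreeAlgebra R (LinkDiagram n)}
    (h : Rel R A n x y) :
    FreeAlgebra.lift R (fun D => bracket R A (n + 1) (insertPuncture j 0 D.word)) x =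
      FreeAlgebra.lift R (fun D => bracket R A (n + 1) (insertPuncture j 0 D.word)) y := by
  cases h with
  | isotopy D D' u v x y hxy hD hD' =>
    simp only [FreeAlgebra.lift_ι_apply, hD, hD']
    exact bracket_insertPuncture_localMove hxy (hD ▸ isDiagram_word D) (hD' ▸ isDiagram_word D') hj
  | skeinRising D D₁ D₂ u v i hD hD₁ hD₂ =>
    simp only [map_add, map_smul, FreeAlgebra.lift_ι_apply, hD, hD₁, hD₂]
    rw [bracket_insertPuncture_cross (hD ▸ isDiagram_word D) hj]
    simp
  | skeinDescending D D₁ D₂ u v i hD hD₁ hD₂ =>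
    simp only [map_add, map_smul, FreeAlgebra.lift_ι_apply, hD, hD₁, hD₂]
    rw [bracket_insertPuncture_cross (hD ▸ isDiagram_word D) hj]
    simp [add_comm]
  | circle D D' u v i hD hD' =>
    simp only [map_smul, FreeAlgebra.lift_ι_apply, hD, hD']
    exact bracket_insertPuncture_circle (hD ▸ isDiagram_word D) (hD' ▸ isDiagram_word D') hj
  | empty D hD =>
    rw [FreeAlgebra.lift_ι_apply, hD, insertPuncture_replicate, bracket_replicate, map_one]
  | stack D₁ D₂ D h =>
    simp only [FreeAlgebra.lift_ι_apply, map_mul]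
    exact bracket_mul ((isDiagram_word D₁).insertPuncture j) ((isDiagram_word D₂).insertPuncture j)
      (h.insertPuncture j)

variable (R A) in
/-- The homomorphism of skein algebras that inserts a puncture above all diagrams after the `j`-th
puncture. It is a section of the homomorphism induced by filling in the new puncture. -/
noncomputable def insertHom (hj : j ≤ n) : SkeinAlgebra R A n →ₐ[R] SkeinAlgebra R A (n + 1) :=
  RingQuot.liftAlgHom R
    ⟨FreeAlgebra.lift R fun D => bracket R A (n + 1) (insertPuncture j 0 D.word),
      fun _ _ h => insertPuncture_rel hj h⟩

theorem insertHom_t (hj : j ≤ n) (I : Finset (Fin n)) :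
    insertHom R A hj (t A I) = bracket R A (n + 1) (insertPuncture j 0 (curve I).word) := by
  rw [insertHom, t, RingQuot.liftAlgHom_mkAlgHom_apply, FreeAlgebra.lift_ι_apply]

end Bracket

section Curves

variable {n : ℕ}

theorem finRange_succAbove (j : Fin (n + 1)) :
    List.finRange (n + 1) = ((List.finRange n).take j).map j.succAbove ++
      j :: ((List.finRange n).drop j).map j.succAbove := by
  refine List.ext_getElem (by simp; omega) fun k hk hk' => Fin.ext ?_
  grind [Fin.succAbove, Fin.val_castSucc, Fin.lt_def]

theorem mem_drop_finRange {j : ℕ} {k : Fin n} : k ∈ (List.finRange n).drop j ↔ j ≤ k := by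
  rw [List.mem_drop_iff_getElem]
  constructor
  · rintro ⟨i, hi, rfl⟩
    simp
  · exact fun h => ⟨k - j, by simp; omega, Fin.ext (by simp; omega)⟩

theorem curveAt_image_succAbove (j : Fin (n + 1)) (I : Finset (Fin n)) (k : Fin n) :
    curveAt (I.image j.succAbove) (j.succAbove k) = curveAt I k := by
  simp [curveAt, strandsBelow, Fin.succAbove_le_succAbove_iff, Fin.succAbove_lt_succAbove_iff]

theorem strandsBelow_image_succAbove (j : Fin (n + 1)) (I : Finset (Fin n)) :
    strandsBelow (I.image j.succAbove) j =
      if (∃ a ∈ I, (a : ℕ) < j) ∧ ∃ b ∈ I, (j : ℕ) ≤ b then 2 else 0 := by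
  have hlt (a : Fin n) : j.succAbove a < j ↔ (a : ℕ) < j := Fin.succAbove_lt_iff_castSucc_lt _ _
  have hle (b : Fin n) : j < j.succAbove b ↔ (j : ℕ) ≤ b := Fin.lt_succAbove_iff_le_castSucc _ _
  simp [strandsBelow, Fin.succAbove_ne, hlt, hle]

theorem word_curve_image_succAbove (j : Fin (n + 1)) (I : Finset (Fin n)) :
    (curve (I.image j.succAbove)).word = ((List.finRange n).take j).flatMap (curveAt I) ++
      puncture (strandsBelow (I.image j.succAbove) j) ::
        ((List.finRange n).drop j).flatMap (curveAt I) := by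
  have hj : curveAt (I.image j.succAbove) j =
      [puncture (strandsBelow (I.image j.succAbove) j)] := by
    simp [curveAt, Fin.succAbove_ne]
  change (List.finRange (n + 1)).flatMap _ = _
  simp only [finRange_succAbove j, List.flatMap_append, List.flatMap_cons, List.flatMap_map,
    curveAt_image_succAbove, hj, List.singleton_append]

theorem word_curve_eq_append (j : ℕ) (I : Finset (Fin n)) :
    (curve I).word = ((List.finRange n).take j).flatMap (curveAt I) ++
      ((List.finRange n).drop j).flatMap (curveAt I) := by
  rw [← List.flatMap_append, List.take_append_drop, curve]

theorem width_curve (j : ℕ) (I : Finset (Fin n)) :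
    width 0 (((List.finRange n).take j).flatMap (curveAt I)) =
      if (∃ a ∈ I, (a : ℕ) < j) ∧ ∃ b ∈ I, j ≤ b then 2 else 0 := by
  have hright := closes_curve I ((List.finRange n).drop j)
    ((List.pairwise_lt_finRange n).sublist (List.drop_sublist _ _)) (by
      simp only [mem_drop_finRange, Fin.lt_def]; omega)
  simp only [mem_drop_finRange, not_le] at hright
  have hall := (curve I).closes
  rw [word_curve_eq_append j, closes_append] at hall
  exact hall.2.unique hright

variable {R : Type*} [CommRing R] {A : Rˣ}

theorem insertHom_t_eq (j : Fin (n + 1)) (I : Finset (Fin n)) :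
    insertHom R A j.is_le (t A I) = t A (I.image j.succAbove) := by
  have hcount : punctureCount (((List.finRange n).take j).flatMap (curveAt I)) = j := by
    rw [punctureCount, countP_curve, List.length_take, List.length_finRange, min_eq_left j.is_le]
  have hI := isDiagram_word (curve I)
  rw [word_curve_eq_append j] at hI
  have hbracket := (bracket_insertPuncture (R := R) (A := A) hI).2
  rw [insertHom_t, ← bracket_curve, word_curve_image_succAbove, strandsBelow_image_succAbove,
    ← width_curve, ← hbracket, hcount, ← word_curve_eq_append]

end Curves

theorem exists_algHom_t_image {R : Type*} [CommRing R] (A : Rˣ) {m n : ℕ} {a : Fin m → Fin n}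
    (ha : StrictMono a) :
    ∃ f : SkeinAlgebra R A m →ₐ[R] SkeinAlgebra R A n, ∀ I, f (t A I) = t A (I.image a) := by
  induction n with
  | zero =>
    obtain rfl : m = 0 := by
      by_contra h
      exact (a ⟨0, Nat.pos_of_ne_zero h⟩).elim0
    exact ⟨AlgHom.id R _, fun I => by simp [Subsingleton.elim a id]⟩
  | succ n ih =>
    by_cases hs : Function.Surjective a
    · obtain rfl : m = n + 1 := by
        simpa using Fintype.card_congr (Equiv.ofBijective a ⟨ha.injective, hs⟩)
      have hid : ⇑(StrictMono.orderIsoOfSurjective a ha hs) = id :=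
        congrArg _ (Subsingleton.elim _ (OrderIso.refl _))
      exact ⟨AlgHom.id R _, fun I => by simp [show a = id from hid]⟩
    · obtain ⟨j, hj⟩ := not_forall.1 hs
      choose b hb using fun k => Fin.exists_succAbove_eq (fun h : a k = j => hj ⟨k, h⟩)
      obtain rfl : a = j.succAbove ∘ b := funext fun k => (hb k).symm
      obtain ⟨f, hf⟩ := ih (fun k l h => Fin.succAbove_lt_succAbove_iff.1 (ha h))
      exact ⟨(insertHom R A j.is_le).comp f, fun I => by
        rw [AlgHom.comp_apply, hf, insertHom_t_eq, Finset.image_image]⟩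

/-! ### The curves around a single puncture are central -/

theorem flatMap_curveAt_singleton {n : ℕ} {i : Fin n} {l : List (Fin n)} (hl : i ∉ l) :
    l.flatMap (curveAt {i}) = List.replicate l.length (puncture 0) := by
  induction l with
  | nil => rfl
  | cons k l ih =>
    obtain ⟨hk, hl⟩ := not_or.1 (mt List.mem_cons.2 hl)
    rw [List.flatMap_cons, ih hl, List.length_cons, List.replicate_succ]
    have hbetween : ¬ (i < k ∧ k < i) := fun h => lt_asymm h.1 h.2
    simp [curveAt, strandsBelow, Ne.symm hk, hbetween]

theorem word_curve_singleton {n : ℕ} (i : Fin n) :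
    (curve {i}).word = List.replicate i (puncture 0) ++ [cup 0, puncture 1, cap 0] ++
      List.replicate (n - (i + 1)) (puncture 0) := by
  have hi : curveAt {i} i = [cup 0, puncture 1, cap 0] := by simp [curveAt, strandsBelow]
  have hdrop : (List.finRange n).drop i = i :: (List.finRange n).drop (i + 1) := by
    rw [List.drop_eq_getElem_cons (by simp), List.getElem_finRange]
    rfl
  have htake : i ∉ (List.finRange n).take i := by
    rw [List.mem_take_iff_getElem]
    rintro ⟨k, hk, hki⟩
    rw [List.getElem_finRange] at hki
    exact (lt_min_iff.1 hk).1.ne (congrArg Fin.val hki)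
  rw [word_curve_eq_append i, hdrop, List.flatMap_cons, hi, flatMap_curveAt_singleton htake,
    flatMap_curveAt_singleton (by simp [mem_drop_finRange]), List.length_take, List.length_drop,
    List.length_finRange, min_eq_left i.is_lt.le, List.append_assoc]

theorem superposed_loop_upper {m p : ℕ} {v : List Slice} (hp : p ≤ m) (hv : Closes m v) :
    Superposed (.replicate m false)
      ([cup 0, puncture 1, cap 0] ++ List.replicate (punctureCount v) (puncture 0))
      (puncture p :: v) ([cup p, puncture (p + 1), cap p] ++ v) := by
  obtain ⟨d, rfl⟩ := Nat.exists_eq_add_of_le hp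
  rw [← List.append_nil v, closes_append] at hv
  have hv := superposed_append_lower hv.1 (w₁ := []) (v := []) (w := []) (by
    rw [show width _ v = 0 from hv.2]; exact .nil)
  have hcap := Superposed.upper (.replicate p false) (.replicate d false) .cap nofun _ _ _
    (by simpa [Kind.outs] using hv)
  have hpuncture := Superposed.puncture (.replicate p false ++ [true]) (true :: .replicate d false)
    _ _ _ (by simpa [Kind.ins] using hcap)
  have hcup := Superposed.upper (.replicate p false) (.replicate d false) .cup nofun _ _ _
    (by simpa [Kind.outs] using hpuncture)
  simpa [Kind.ins, cup, cap, List.count_replicate] using hcup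

theorem superposed_loop_lower {m p : ℕ} {v : List Slice} (hp : p ≤ m) (hv : Closes m v) :
    Superposed (.replicate m true) (puncture p :: v)
      ([cup 0, puncture 1, cap 0] ++ List.replicate (punctureCount v) (puncture 0))
      ([cup p, puncture (p + 1), cap p] ++ v) := by
  obtain ⟨d, rfl⟩ := Nat.exists_eq_add_of_le hp
  rw [← List.append_nil v, closes_append] at hv
  have hv := superposed_append_upper hv.1 (w₂ := []) (v := []) (w := []) (by
    rw [show width _ v = 0 from hv.2]; exact .nil)
  have hcap := Superposed.lower (.replicate p true) (.replicate d true) .cap nofun _ _ _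
    (by simpa [Kind.outs] using hv)
  have hpuncture := Superposed.puncture (.replicate p true ++ [false]) (false :: .replicate d true)
    _ _ _ (by simpa [Kind.ins] using hcap)
  have hcup := Superposed.lower (.replicate p true) (.replicate d true) .cup nofun _ _ _
    (by simpa [Kind.outs] using hpuncture)
  simpa [Kind.ins, cup, cap, List.count_replicate] using hcup

theorem exists_eq_append_puncture {i : ℕ} {w : List Slice} (h : i < punctureCount w) :
    ∃ u p v, w = u ++ puncture p :: v ∧ punctureCount u = i := by
  induction w generalizing i with
  | nil => exact absurd h (Nat.not_lt_zero i)
  | cons s w ih =>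
    obtain ⟨k, p⟩ := s
    by_cases hs : k = .puncture ∧ i = 0
    · obtain ⟨rfl, rfl⟩ := hs
      exact ⟨[], p, w, rfl, rfl⟩
    · rw [punctureCount_cons] at h
      obtain ⟨u, p', v, rfl, hu⟩ := ih (i := i - if k = .puncture then 1 else 0) (by grind)
      refine ⟨⟨k, p⟩ :: u, p', v, rfl, ?_⟩
      rw [punctureCount_cons, hu]
      split_ifs <;> grind

section Center

variable {R : Type*} [CommRing R] {A : Rˣ} {n : ℕ}

theorem commute_t_singleton_bracket (i : Fin n) {w : List Slice} (h : IsDiagram n w) :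
    Commute (t A {i}) (bracket R A n w) := by
  obtain ⟨u, p, v, rfl, hu⟩ := exists_eq_append_puncture (i.is_lt.trans_eq h.punctures.symm)
  have hv : punctureCount v = n - (i + 1) := by
    have := h.punctures
    simp only [punctureCount_append, punctureCount_cons, puncture, if_true] at this
    omega
  obtain ⟨hfits, hp, hv'⟩ := closes_append.1 h.closes
  have hi := isDiagram_word (curve {i})
  have hupper := superposed_append_lower hfits (superposed_loop_upper hp hv')
  have hlower := superposed_append_upper hfits (superposed_loop_lower hp hv')
  rw [hu, hv, ← List.append_assoc, ← word_curve_singleton] at hupper hlower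
  rw [Commute, SemiconjBy, ← bracket_curve, bracket_mul hi h hupper, bracket_mul h hi hlower]

theorem mem_center_of_commute {z : SkeinAlgebra R A n}
    (h : ∀ D : LinkDiagram n, Commute z (bracket R A n D.word)) :
    z ∈ Subalgebra.center R (SkeinAlgebra R A n) := by
  refine Subalgebra.mem_center_iff.2 fun b => ?_
  obtain ⟨x, rfl⟩ := RingQuot.mkAlgHom_surjective R (Rel R A n) b
  suffices Commute z (RingQuot.mkAlgHom R (Rel R A n) x) from this.eq.symm
  induction x using FreeAlgebra.induction with
  | grade0 r => simpa only [AlgHom.commutes] using Algebra.commute_algebraMap_right r z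
  | grade1 D => exact bracket_word (R := R) (A := A) D ▸ h D
  | mul x y hx hy => simpa using hx.mul_right hy
  | add x y hx hy => simpa using hx.add_right hy

theorem t_singleton_mem_center (i : Fin n) :
    t A {i} ∈ Subalgebra.center R (SkeinAlgebra R A n) :=
  mem_center_of_commute fun D => commute_t_singleton_bracket i (isDiagram_word D)

end Center

/-! ### Relations between the curves -/

theorem coe_finRotate_pow (m v : ℕ) : ⇑(finRotate (m + 1) ^ v) = (· + Fin.ofNat (m + 1) v) := by
  induction v with
  | zero => exact funext fun k => by simp
  | succ v ih =>
    funext k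
    rw [pow_succ', Equiv.Perm.mul_apply, ih, finRotate_apply, add_assoc]
    exact congrArg (k + ·) (Fin.ext (by simp [Fin.val_add]))

theorem cyclicOrder_iff {m n : ℕ} {i : Fin (m + 1) → Fin n} :
    CyclicOrder i ↔ ∃ a : Fin (m + 1) → Fin n, StrictMono a ∧ ∃ v, i = fun k => a (k + v) := by
  constructor <;> rintro ⟨a, ha, v, rfl⟩ <;> refine ⟨a, ha, ?_⟩
  · exact ⟨_, by rw [coe_finRotate_pow]; rfl⟩
  · exact ⟨v, by rw [coe_finRotate_pow, Fin.ofNat_val_eq_self]; rfl⟩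

theorem CyclicOrder.injective {m n : ℕ} {i : Fin m → Fin n} (hi : CyclicOrder i) :
    Function.Injective i := by
  obtain ⟨a, ha, v, rfl⟩ := hi
  exact ha.injective.comp (Equiv.injective _)

theorem CyclicOrder.comp {l m n : ℕ} {i : Fin (m + 1) → Fin n} (hi : CyclicOrder i)
    {e : Fin (l + 1) → Fin (m + 1)} (he : ∀ v, ∃ w, ∀ j k, j < k → e (j - w) + v < e (k - w) + v) :
    CyclicOrder (i ∘ e) := by
  obtain ⟨a, ha, v, rfl⟩ := cyclicOrder_iff.1 hi
  obtain ⟨w, hw⟩ := he v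
  exact cyclicOrder_iff.2 ⟨fun k => a (e (k - w) + v), fun j k h => ha (hw j k h), w, by
    simp [Function.comp_def]⟩

/-- The polynomial obtained from `T` by rotating the punctures cyclically by `v` steps. -/
def Combination.rotate {n : ℕ} (v : Fin n) (T : Combination (List (Finset (Fin n)))) :
    Combination (List (Finset (Fin n))) :=
  T.map fun x => ⟨x.coeff, x.degree, x.atom.map fun I => I.image (· + v)⟩

section Relations

variable {R : Type*} [CommRing R] {A : Rˣ} {n : ℕ}

theorem Combination.map_eval {S S' : Type*} [AddCommGroup S] [Module R S] [AddCommGroup S']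
    [Module R S'] {ι : Type} (f : S →ₗ[R] S') (g : ι → S) (T : Combination ι) :
    f (T.eval A g) = T.eval A (f ∘ g) := by
  simp [eval, map_list_sum, Function.comp_def]

theorem eval_image_eq_zero {m : ℕ} {T : Combination (List (Finset (Fin (m + 1))))}
    (hT : ∀ v, isZero ((T.rotate v).map fun x => ⟨x.coeff, 2 * x.degree, x.atom⟩))
    {i : Fin (m + 1) → Fin n} (hi : CyclicOrder i) :
    T.eval (A ^ 2) (fun l => (l.map fun I => t A (I.image i)).prod) = 0 := by
  obtain ⟨a, ha, v, rfl⟩ := cyclicOrder_iff.1 hi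
  obtain ⟨f, hf⟩ := exists_algHom_t_image A ha
  have h := congrArg f.toLinearMap (eval_eq_zero_of_isZero (A := A) (hT v))
  rw [Combination.map_eval, map_zero] at h
  rw [← h]
  simp [Combination.eval, Combination.rotate, Function.comp_def, hf, map_list_prod, zpow_mul,
    Finset.image_image, -Finset.image_add_right]

theorem commute_t_pair_pair {i : Fin 4 → Fin n} (hi : CyclicOrder i) :
    Commute (t A {i 0, i 1}) (t A {i 2, i 3}) := by
  have h := eval_image_eq_zero (A := A) (T :=
    [⟨1, 0, [{0, 1}, {2, 3}]⟩, ⟨-1, 0, [{2, 3}, {0, 1}]⟩]) (by decide +kernel) hi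
  simpa [Combination.eval, Finset.image_insert, add_eq_zero_iff_eq_neg, Commute, SemiconjBy]
    using h

variable {q q' : R} (hq : q = A ^ 2) (hq' : q' = ((A⁻¹ : Rˣ) : R) ^ 2)

include hq hq'

theorem t_pair_mul_t_pair_of_cyclicOrder_three {i : Fin 3 → Fin n} (hi : CyclicOrder i) :
    q • (t A {i 0, i 1} * t A {i 0, i 2}) - q' • (t A {i 0, i 2} * t A {i 0, i 1}) =
      (q ^ 2 - q' ^ 2) • t A {i 1, i 2}
        + (q - q') • (t A {i 0} * t A {i 0, i 1, i 2} + t A {i 1} * t A {i 2}) := by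
  have h := eval_image_eq_zero (A := A) (T :=
    [⟨1, 1, [{0, 1}, {0, 2}]⟩, ⟨-1, -1, [{0, 2}, {0, 1}]⟩, ⟨-1, 2, [{1, 2}]⟩, ⟨1, -2, [{1, 2}]⟩,
      ⟨-1, 1, [{0}, {0, 1, 2}]⟩, ⟨1, -1, [{0}, {0, 1, 2}]⟩, ⟨-1, 1, [{1}, {2}]⟩,
      ⟨1, -1, [{1}, {2}]⟩]) (by decide +kernel) hi
  simp only [Combination.eval_cons, Combination.eval_nil, List.map_cons, List.map_nil,
    List.prod_cons, List.prod_nil, Finset.image_insert, Finset.image_singleton, mul_one,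
    zpow_neg, zpow_ofNat, ← inv_pow, Units.val_pow_eq_pow_val,
    Int.cast_neg, Int.cast_one, ← hq, ← hq'] at h
  linear_combination (norm := module) h

theorem t_pair_mul_t_pair {i : Fin 4 → Fin n} (hi : CyclicOrder i) :
    t A {i 0, i 2} * t A {i 1, i 3} =
      q ^ 2 • (t A {i 0, i 1} * t A {i 2, i 3}) + q' ^ 2 • (t A {i 0, i 3} * t A {i 1, i 2})
        + (q + q') • t A {i 0, i 1, i 2, i 3}
        + t A {i 0} * t A {i 1, i 2, i 3} + t A {i 1} * t A {i 0, i 2, i 3}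
        + t A {i 2} * t A {i 0, i 1, i 3} + t A {i 3} * t A {i 0, i 1, i 2}
        + q • (t A {i 0} * t A {i 1} * t A {i 2, i 3} + t A {i 2} * t A {i 3} * t A {i 0, i 1})
        + q' • (t A {i 0} * t A {i 3} * t A {i 1, i 2} + t A {i 1} * t A {i 2} * t A {i 0, i 3})
        + t A {i 0} * t A {i 1} * t A {i 2} * t A {i 3} := by
  have h := eval_image_eq_zero (A := A) (T :=
    [⟨-1, 0, [{0, 2}, {1, 3}]⟩, ⟨1, 2, [{0, 1}, {2, 3}]⟩, ⟨1, -2, [{0, 3}, {1, 2}]⟩,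
      ⟨1, 1, [{0, 1, 2, 3}]⟩, ⟨1, -1, [{0, 1, 2, 3}]⟩, ⟨1, 0, [{0}, {1, 2, 3}]⟩,
      ⟨1, 0, [{1}, {0, 2, 3}]⟩, ⟨1, 0, [{2}, {0, 1, 3}]⟩, ⟨1, 0, [{3}, {0, 1, 2}]⟩,
      ⟨1, 1, [{0}, {1}, {2, 3}]⟩, ⟨1, 1, [{2}, {3}, {0, 1}]⟩, ⟨1, -1, [{0}, {3}, {1, 2}]⟩,
      ⟨1, -1, [{1}, {2}, {0, 3}]⟩, ⟨1, 0, [{0}, {1}, {2}, {3}]⟩]) (by decide +kernel) hi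
  simp only [Combination.eval_cons, Combination.eval_nil, List.map_cons, List.map_nil,
    List.prod_cons, List.prod_nil, Finset.image_insert, Finset.image_singleton, mul_one,
    ← mul_assoc, zpow_neg, zpow_ofNat, ← inv_pow, Units.val_pow_eq_pow_val,
    Int.cast_neg, Int.cast_one, ← hq, ← hq'] at h
  linear_combination (norm := module) -h

theorem t_pair_mul_t_triple {i : Fin 5 → Fin n} (hi : CyclicOrder i) :
    t A {i 0, i 2} * t A {i 1, i 3, i 4} =
      q ^ 2 • (t A {i 0, i 1} * t A {i 2, i 3, i 4})
        + q' ^ 2 • (t A {i 1, i 2} * t A {i 0, i 3, i 4})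
        + (q + q') • t A {i 0, i 1, i 2, i 3, i 4}
        + t A {i 0} * t A {i 1, i 2, i 3, i 4} + t A {i 1} * t A {i 0, i 2, i 3, i 4}
        + t A {i 2} * t A {i 0, i 1, i 3, i 4} + t A {i 3, i 4} * t A {i 0, i 1, i 2}
        + q • (t A {i 0} * t A {i 1} * t A {i 2, i 3, i 4}
          + t A {i 2} * t A {i 0, i 1} * t A {i 3, i 4})
        + q' • (t A {i 0} * t A {i 1, i 2} * t A {i 3, i 4}
          + t A {i 1} * t A {i 2} * t A {i 0, i 3, i 4})
        + t A {i 0} * t A {i 1} * t A {i 2} * t A {i 3, i 4} := by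
  have h := eval_image_eq_zero (A := A) (T :=
    [⟨-1, 0, [{0, 2}, {1, 3, 4}]⟩, ⟨1, 2, [{0, 1}, {2, 3, 4}]⟩, ⟨1, -2, [{1, 2}, {0, 3, 4}]⟩,
      ⟨1, 1, [{0, 1, 2, 3, 4}]⟩, ⟨1, -1, [{0, 1, 2, 3, 4}]⟩, ⟨1, 0, [{0}, {1, 2, 3, 4}]⟩,
      ⟨1, 0, [{1}, {0, 2, 3, 4}]⟩, ⟨1, 0, [{2}, {0, 1, 3, 4}]⟩, ⟨1, 0, [{3, 4}, {0, 1, 2}]⟩,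
      ⟨1, 1, [{0}, {1}, {2, 3, 4}]⟩, ⟨1, 1, [{2}, {0, 1}, {3, 4}]⟩,
      ⟨1, -1, [{0}, {1, 2}, {3, 4}]⟩, ⟨1, -1, [{1}, {2}, {0, 3, 4}]⟩,
      ⟨1, 0, [{0}, {1}, {2}, {3, 4}]⟩]) (by decide +kernel) hi
  simp only [Combination.eval_cons, Combination.eval_nil, List.map_cons, List.map_nil,
    List.prod_cons, List.prod_nil, Finset.image_insert, Finset.image_singleton, mul_one,
    ← mul_assoc, zpow_neg, zpow_ofNat, ← inv_pow, Units.val_pow_eq_pow_val,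
    Int.cast_neg, Int.cast_one, ← hq, ← hq'] at h
  linear_combination (norm := module) -h

theorem t_pair_mul_t_triple_alternating {i : Fin 4 → Fin n} (hi : CyclicOrder i) :
    q ^ 2 • (t A {i 0, i 1} * t A {i 0, i 2, i 3}) - t A {i 0, i 2} * t A {i 0, i 1, i 3}
        + q' ^ 2 • (t A {i 0, i 3} * t A {i 0, i 1, i 2}) =
      (q ^ 3 + q' ^ 3) • t A {i 1, i 2, i 3}
        + (q ^ 2 + q' ^ 2 - 1) • (t A {i 0} * t A {i 0, i 1, i 2, i 3})
        + q ^ 2 • (t A {i 1} * t A {i 2, i 3} + t A {i 2} * t A {i 1, i 3})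
        + q' ^ 2 • (t A {i 3} * t A {i 1, i 2})
        + q • (t A {i 0} * t A {i 2} * t A {i 0, i 1, i 3} + t A {i 1} * t A {i 2} * t A {i 3}
          - t A {i 2} * t A {i 0, i 1} * t A {i 0, i 3}) := by
  have h := eval_image_eq_zero (A := A) (T :=
    [⟨1, 2, [{0, 1}, {0, 2, 3}]⟩, ⟨-1, 0, [{0, 2}, {0, 1, 3}]⟩, ⟨1, -2, [{0, 3}, {0, 1, 2}]⟩,
      ⟨-1, 3, [{1, 2, 3}]⟩, ⟨-1, -3, [{1, 2, 3}]⟩, ⟨-1, 2, [{0}, {0, 1, 2, 3}]⟩,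
      ⟨-1, -2, [{0}, {0, 1, 2, 3}]⟩, ⟨1, 0, [{0}, {0, 1, 2, 3}]⟩, ⟨-1, 2, [{1}, {2, 3}]⟩,
      ⟨-1, -2, [{3}, {1, 2}]⟩, ⟨-1, 2, [{2}, {1, 3}]⟩, ⟨-1, 1, [{0}, {2}, {0, 1, 3}]⟩,
      ⟨-1, 1, [{1}, {2}, {3}]⟩, ⟨1, 1, [{2}, {0, 1}, {0, 3}]⟩]) (by decide +kernel) hi
  simp only [Combination.eval_cons, Combination.eval_nil, List.map_cons, List.map_nil,
    List.prod_cons, List.prod_nil, Finset.image_insert, Finset.image_singleton, mul_one,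
    ← mul_assoc, zpow_neg, zpow_ofNat, ← inv_pow, Units.val_pow_eq_pow_val,
    Int.cast_neg, Int.cast_one, ← hq, ← hq'] at h
  linear_combination (norm := module) h

end Relations

/-! ### The reduced curves -/

open MvPolynomial (X)

/-- Inclusion-exclusion: the sum over the subsets `J` of `I` of `(∏ i ∈ I \ J, y i) • τ J`. -/
def reduced {ι Z S : Type*} [DecidableEq ι] [CommRing Z] [AddCommGroup S] [Module Z S]
    (y : ι → Z) (τ : Finset ι → S) (I : Finset ι) : S :=
  ∑ J ∈ I.powerset, (∏ i ∈ I \ J, y i) • τ J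

section

variable {ι Z S : Type*} [DecidableEq ι] [CommRing Z] [AddCommGroup S] [Module Z S]
  (y : ι → Z) (τ : Finset ι → S)

theorem reduced_insert {a : ι} {I : Finset ι} (ha : a ∉ I) :
    reduced y τ (insert a I) = y a • reduced y τ I + reduced y (fun J => τ (insert a J)) I := by
  rw [reduced, Finset.sum_powerset_insert ha, reduced, reduced, Finset.smul_sum]
  refine congrArg₂ _ (Finset.sum_congr rfl fun J hJ => ?_) (Finset.sum_congr rfl fun J _ => ?_)
  · have : a ∉ J := fun h => ha (Finset.mem_powerset.1 hJ h)
    rw [Finset.insert_sdiff_of_notMem _ this, Finset.prod_insert (by simp [ha]), mul_smul]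
  · rw [Finset.insert_sdiff_insert, Finset.sdiff_insert, Finset.erase_eq_of_notMem (by simp [ha])]

theorem reduced_singleton (a : ι) : reduced y τ {a} = y a • τ ∅ + τ {a} := by
  rw [← insert_empty_eq, reduced_insert y τ (by simp)]
  simp [reduced]

end

section

variable {R : Type*} [CommRing R] (A : Rˣ) (β : R) {n : ℕ}

variable (n) in
/-- The homomorphism from a polynomial ring to the center that sends the variables to the central
curves `t_i`. -/
noncomputable def centralHom :
    MvPolynomial (Fin n) R →ₐ[R] Subalgebra.center R (SkeinAlgebra R A n) :=
  MvPolynomial.aeval fun i => ⟨t A {i}, t_singleton_mem_center i⟩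

noncomputable instance : Algebra (MvPolynomial (Fin n) R) (SkeinAlgebra R A n) :=
  ((Subalgebra.val _).comp (centralHom A n)).toRingHom.toAlgebra' fun z x =>
    (Subalgebra.mem_center_iff.1 (centralHom A n z).2 x).symm

instance : IsScalarTower R (MvPolynomial (Fin n) R) (SkeinAlgebra R A n) :=
  .of_algebraMap_eq fun r => (AlgHom.commutes _ r).symm

theorem t_singleton (i : Fin n) : t A {i} = (X i : MvPolynomial (Fin n) R) • 1 := by
  rw [← Algebra.algebraMap_eq_smul_one]
  exact (congrArg Subtype.val (MvPolynomial.aeval_X (R := R) _ i) :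
    (centralHom A n (X i) : SkeinAlgebra R A n) = t A {i}).symm

/-- The simple closed curve around the punctures in `I`; unlike `t A ∅`, which is the empty link,
`loop A ∅` is the trivial circle. -/
def loop (I : Finset (Fin n)) : SkeinAlgebra R A n :=
  if I = ∅ then circleValue R A • 1 else t A I

theorem loop_empty : loop A (∅ : Finset (Fin n)) = circleValue R A • 1 := if_pos rfl

theorem loop_insert (i : Fin n) (I : Finset (Fin n)) : loop A (insert i I) = t A (insert i I) :=
  if_neg (Finset.insert_ne_empty i I)

theorem loop_singleton (i : Fin n) : loop A {i} = (X i : MvPolynomial (Fin n) R) • 1 :=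
  (loop_insert A i ∅).trans (t_singleton A i)

/-- The element `s_I = ∑_{J ⊆ I} (∏_{i ∈ I ∖ J} β t_i) t_J`, where `t_∅` stands for the trivial
circle. For `α β = 1` and two or three indices it is `s_{ij}` or `s_{ijk}`. -/
noncomputable def reducedCurve (I : Finset (Fin n)) : SkeinAlgebra R A n :=
  reduced (fun i => algebraMap R (MvPolynomial (Fin n) R) β * X i) (loop A) I

end

section

variable {R : Type*} [CommRing R] {A : Rˣ} {β q q' : R} {n : ℕ}
  (hq : q = A ^ 2) (hq' : q' = ((A⁻¹ : Rˣ) : R) ^ 2) (hβ : (q + q') * β = 1)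

include hq hq'

theorem mul_eq_one_of_eq_sq : q * q' = 1 := by
  rw [hq, hq', ← mul_pow, Units.mul_inv, one_pow]

include hβ

theorem reducedCurve_pair {i j : Fin n} (hij : i ≠ j) : reducedCurve A β {i, j} = s₂ A β i j := by
  rw [s₂, if_neg hij, reducedCurve, reduced_insert _ _ (by simpa using hij)]
  simp only [reduced_singleton, loop_empty, loop_singleton, loop_insert, insert_empty_eq,
    circleValue, ← hq, ← hq', t_singleton, smul_mul_assoc, one_mul]
  have hβ' := congrArg (algebraMap R (MvPolynomial (Fin n) R)) hβ
  simp only [map_mul, map_add, map_one] at hβ'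
  match_scalars <;> grind

theorem reducedCurve_triple {i j k : Fin n} (hij : i ≠ j) (hik : i ≠ k) (hjk : j ≠ k) :
    reducedCurve A β {i, j, k} = s₃ A β i j k := by
  rw [s₃, reducedCurve]
  simp (disch := simp [hij, hik, hjk]) only [reduced_insert, reduced_singleton, loop_empty,
    loop_singleton, loop_insert, insert_empty_eq, circleValue, ← hq, ← hq', t_singleton,
    smul_mul_assoc, one_mul, two_mul]
  have hβ' := congrArg (algebraMap R (MvPolynomial (Fin n) R)) hβ
  simp only [map_mul, map_add, map_one] at hβ'
  match_scalars <;> grind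

theorem reducedCurve_mul {i : Fin 4 → Fin n} (hi : CyclicOrder i) :
    reducedCurve A β {i 0, i 2} * reducedCurve A β {i 1, i 3} =
      q ^ 2 • (reducedCurve A β {i 0, i 1} * reducedCurve A β {i 2, i 3})
        + q' ^ 2 • (reducedCurve A β {i 0, i 3} * reducedCurve A β {i 1, i 2})
        + (q + q') • reducedCurve A β {i 0, i 1, i 2, i 3} := by
  have h := t_pair_mul_t_pair hq hq' hi
  simp only [reducedCurve]
  simp (disch := simp [hi.injective.eq_iff]) only [reduced_insert, reduced_singleton,
    insert_empty_eq, loop_empty, loop_singleton, loop_insert, circleValue, ← hq, ← hq']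
  simp only [t_singleton, mul_add, add_mul, smul_mul_assoc, mul_smul_comm, one_mul, mul_one] at h ⊢
  rw [h]
  clear h
  have hβ' := congrArg (algebraMap R (MvPolynomial (Fin n) R)) hβ
  have hqq' := congrArg (algebraMap R (MvPolynomial (Fin n) R)) (mul_eq_one_of_eq_sq hq hq')
  simp only [map_mul, map_add, map_one] at hβ' hqq'
  clear hq hq' hβ
  match_scalars <;> grind

set_option maxHeartbeats 400000 in
theorem reducedCurve_mul_triple {i : Fin 5 → Fin n} (hi : CyclicOrder i) :
    reducedCurve A β {i 0, i 2} * reducedCurve A β {i 1, i 3, i 4} =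
      q ^ 2 • (reducedCurve A β {i 0, i 1} * reducedCurve A β {i 2, i 3, i 4})
        + q' ^ 2 • (reducedCurve A β {i 1, i 2} * reducedCurve A β {i 0, i 3, i 4})
        + reducedCurve A β {i 3, i 4} * reducedCurve A β {i 0, i 1, i 2}
        + (q + q') • reducedCurve A β {i 0, i 1, i 2, i 3, i 4} := by
  have h := t_pair_mul_t_triple hq hq' hi
  have h₃ := t_pair_mul_t_pair hq hq' (hi.comp (e := ![0, 1, 2, 3]) (by decide))
  have h₄ := t_pair_mul_t_pair hq hq' (hi.comp (e := ![0, 1, 2, 4]) (by decide))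
  have h₀₁ := (commute_t_pair_pair (A := A) (hi.comp (e := ![0, 1, 3, 4]) (by decide))).eq
  have h₀₂ := (commute_t_pair_pair (A := A) (hi.comp (e := ![0, 2, 3, 4]) (by decide))).eq
  have h₁₂ := (commute_t_pair_pair (A := A) (hi.comp (e := ![1, 2, 3, 4]) (by decide))).eq
  have h₀₃ := (commute_t_pair_pair (A := A) (hi.comp (e := ![1, 2, 3, 0]) (by decide))).eq
  have h₀₄ := (commute_t_pair_pair (A := A) (hi.comp (e := ![1, 2, 4, 0]) (by decide))).eq
  simp only [Function.comp_apply, Matrix.cons_val] at h₃ h₄ h₀₁ h₀₂ h₁₂ h₀₃ h₀₄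
  rw [Finset.pair_comm _ (i 0)] at h₀₃ h₀₄
  simp only [reducedCurve]
  simp (disch := simp [hi.injective.eq_iff]) only [reduced_insert, reduced_singleton,
    insert_empty_eq, loop_empty, loop_singleton, loop_insert, circleValue, ← hq, ← hq']
  simp only [t_singleton, mul_add, add_mul, smul_mul_assoc, mul_smul_comm, one_mul, mul_one]
    at h h₃ h₄ ⊢
  rw [h, h₃, h₄, h₀₁, h₀₂, h₁₂, h₀₃, h₀₄]
  clear h h₃ h₄ h₀₁ h₀₂ h₁₂ h₀₃ h₀₄
  have hβ' := congrArg (algebraMap R (MvPolynomial (Fin n) R)) hβ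
  have hqq' := congrArg (algebraMap R (MvPolynomial (Fin n) R)) (mul_eq_one_of_eq_sq hq hq')
  simp only [map_mul, map_add, map_one] at hβ' hqq'
  clear hq hq' hβ
  match_scalars <;> grind

theorem reducedCurve_alternating {i : Fin 4 → Fin n} (hi : CyclicOrder i) :
    q ^ 2 • (reducedCurve A β {i 0, i 1} * reducedCurve A β {i 0, i 2, i 3})
        - reducedCurve A β {i 0, i 2} * reducedCurve A β {i 0, i 1, i 3}
        + q' ^ 2 • (reducedCurve A β {i 0, i 3} * reducedCurve A β {i 0, i 1, i 2}) =
      (q ^ 2 + q' ^ 2 - 1) • (s₂ A β (i 0) (i 0) * reducedCurve A β {i 1, i 2, i 3})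
        + (q - q') ^ 2 • (t A {i 0} * reducedCurve A β {i 0, i 1, i 2, i 3}) := by
  have h := t_pair_mul_t_triple_alternating hq hq' hi
  have h₁₂ := t_pair_mul_t_pair_of_cyclicOrder_three hq hq' (hi.comp (e := ![0, 1, 2]) (by decide))
  have h₁₃ := t_pair_mul_t_pair_of_cyclicOrder_three hq hq' (hi.comp (e := ![0, 1, 3]) (by decide))
  have h₂₃ := t_pair_mul_t_pair_of_cyclicOrder_three hq hq' (hi.comp (e := ![0, 2, 3]) (by decide))
  have h₄ := t_pair_mul_t_pair hq hq' hi
  simp only [Function.comp_apply, Matrix.cons_val] at h₁₂ h₁₃ h₂₃ h₄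
  simp only [reducedCurve, s₂, if_true, pow_two (t A {i 0}), ← hq, ← hq',
    Algebra.algebraMap_eq_smul_one (R := R) (A := SkeinAlgebra R A n)]
  simp (disch := simp [hi.injective.eq_iff]) only [reduced_insert, reduced_singleton,
    insert_empty_eq, loop_empty, loop_singleton, loop_insert, circleValue, ← hq, ← hq']
  simp only [t_singleton, mul_add, add_mul, sub_mul, smul_mul_assoc, mul_smul_comm, one_mul,
    mul_one] at h h₁₂ h₁₃ h₂₃ h₄ ⊢
  linear_combination (norm := skip) h
    + (q * β) • (X (i 3) : MvPolynomial (Fin n) R) • h₁₂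
    - (q' * β) • (X (i 2) : MvPolynomial (Fin n) R) • h₁₃
    - (q' * β) • (X (i 1) : MvPolynomial (Fin n) R) • h₂₃
    - β • (X (i 0) : MvPolynomial (Fin n) R) • h₄
  clear h h₄ h₁₂ h₁₃ h₂₃
  have hβ' := congrArg (algebraMap R (MvPolynomial (Fin n) R)) hβ
  have hqq' := congrArg (algebraMap R (MvPolynomial (Fin n) R)) (mul_eq_one_of_eq_sq hq hq')
  simp only [map_mul, map_add, map_one] at hβ' hqq'
  clear hq hq' hβ
  match_scalars <;> grind

end

/-! ### The type II relations -/

section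

variable {R : Type*} [CommRing R] {A : Rˣ} {β q q' : R} {n : ℕ}

theorem s₂_comm (i j : Fin n) : s₂ A β i j = s₂ A β j i := by
  rcases eq_or_ne i j with rfl | hij
  · rfl
  · rw [s₂, s₂, if_neg hij, if_neg hij.symm, Finset.pair_comm,
      Subalgebra.mem_center_iff.1 (t_singleton_mem_center j)]

theorem s₃_rotate (i j k : Fin n) : s₃ A β j k i = s₃ A β i j k := by
  simp only [s₃, Finset.pair_comm _ i, Finset.insert_comm _ i, t_singleton, smul_mul_assoc, one_mul]
  module

variable (hq : q = A ^ 2) (hq' : q' = ((A⁻¹ : Rˣ) : R) ^ 2) (hβ : (q + q') * β = 1)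

include hq hq' hβ

theorem s₂_mul_s₃_of_cyclicOrder_five {i : Fin 5 → Fin n} (hi : CyclicOrder i) :
    q ^ 2 • (s₂ A β (i 0) (i 4) * s₃ A β (i 1) (i 2) (i 3))
        - s₂ A β (i 1) (i 4) * s₃ A β (i 0) (i 2) (i 3)
        + s₂ A β (i 2) (i 4) * s₃ A β (i 0) (i 1) (i 3)
        - q' ^ 2 • (s₂ A β (i 3) (i 4) * s₃ A β (i 0) (i 1) (i 2)) =
      (q - q') • (q' • (s₂ A β (i 0) (i 1) * s₃ A β (i 2) (i 3) (i 4))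
        + q • (s₂ A β (i 2) (i 3) * s₃ A β (i 0) (i 1) (i 4))) := by
  have h₁₄ := reducedCurve_mul_triple hq hq' hβ (hi.comp (e := ![4, 0, 1, 2, 3]) (by decide))
  have h₂₄ := reducedCurve_mul_triple hq hq' hβ (hi.comp (e := ![2, 3, 4, 0, 1]) (by decide))
  simp (disch := simp [hi.injective.eq_iff]) only [← reducedCurve_pair hq hq' hβ,
    ← reducedCurve_triple hq hq' hβ]
  simp only [Function.comp_apply, Matrix.cons_val, Finset.insert_comm (i 4), Finset.pair_comm (i 4)]
    at h₁₄
  simp only [Function.comp_apply, Matrix.cons_val, Finset.insert_comm _ (i 0),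
    Finset.insert_comm (i 2) (i 1), Finset.insert_comm (i 3) (i 1), Finset.pair_comm (i 2) (i 1),
    Finset.pair_comm (i 3) (i 1), Finset.pair_comm (i 4) (i 1)] at h₂₄
  have hqq' := mul_eq_one_of_eq_sq hq hq'
  linear_combination (norm := skip) h₂₄ - h₁₄
  match_scalars <;> grind

theorem s₂_mul_s₃_of_cyclicOrder_four {i : Fin 4 → Fin n} (hi : CyclicOrder i) :
    q ^ 2 • (s₂ A β (i 0) (i 1) * s₃ A β (i 0) (i 2) (i 3))
        - s₂ A β (i 0) (i 2) * s₃ A β (i 0) (i 1) (i 3)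
        + q' ^ 2 • (s₂ A β (i 0) (i 3) * s₃ A β (i 0) (i 1) (i 2))
        - (q ^ 2 + q' ^ 2 - 1) • (s₂ A β (i 0) (i 0) * s₃ A β (i 1) (i 2) (i 3)) =
      ((q - q') ^ 2 * β) • (t A {i 0} * (s₂ A β (i 0) (i 2) * s₂ A β (i 1) (i 3)
        - q ^ 2 • (s₂ A β (i 0) (i 1) * s₂ A β (i 2) (i 3))
        - q' ^ 2 • (s₂ A β (i 0) (i 3) * s₂ A β (i 1) (i 2)))) := by
  simp (disch := simp [hi.injective.eq_iff]) only [← reducedCurve_pair hq hq' hβ,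
    ← reducedCurve_triple hq hq' hβ]
  rw [reducedCurve_mul hq hq' hβ hi, reducedCurve_alternating hq hq' hβ hi, add_sub_cancel_left,
    sub_sub, add_sub_cancel_left, mul_smul_comm, smul_smul, mul_assoc, mul_comm β, hβ, mul_one]

end

section

variable {R : Type*} [CommRing R] (A : Rˣ) (β : R) {n : ℕ}

/-- The left-hand side of the classical type II relation for the indices `a 0, …, a 3` and `c`. -/
noncomputable def typeTwo (a : Fin 4 → Fin n) (c : Fin n) : SkeinAlgebra R A n :=
  s₂ A β (a 0) c * s₃ A β (a 1) (a 2) (a 3) - s₂ A β (a 1) c * s₃ A β (a 0) (a 2) (a 3)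
    + s₂ A β (a 2) c * s₃ A β (a 0) (a 1) (a 3) - s₂ A β (a 3) c * s₃ A β (a 0) (a 1) (a 2)

theorem typeTwo_rotate (a : Fin 4 → Fin n) (c : Fin n) :
    typeTwo A β (fun k => a (k + 1)) c = -typeTwo A β a c := by
  simp only [typeTwo, Fin.reduceAdd, s₃_rotate (a 0)]
  abel

theorem typeTwo_add_eq_zero {a : Fin 4 → Fin n} {c : Fin n} {v : Fin 4} :
    typeTwo A β (fun k => a (k + v)) c = 0 ↔ typeTwo A β a c = 0 := by
  induction v using Fin.induction with
  | zero => simp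
  | succ v ih =>
    rw [iff_comm, ← ih, ← neg_eq_zero, ← typeTwo_rotate]
    simp only [add_right_comm, add_assoc, Fin.coeSucc_eq_succ]

variable {A β}

theorem eq_or_cyclicOrder_of_strictMono {a : Fin 4 → Fin n} (ha : StrictMono a) (c : Fin n) :
    (∃ v, a v = c) ∨ ∃ v, CyclicOrder ![a (0 + v), a (1 + v), a (2 + v), a (3 + v), c] := by
  have cyclic {b : Fin 5 → Fin n} (hb : b 0 < b 1 ∧ b 1 < b 2 ∧ b 2 < b 3 ∧ b 3 < b 4)
      (v : Fin 5) : CyclicOrder ![b (0 + v), b (1 + v), b (2 + v), b (3 + v), b (4 + v)] :=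
    cyclicOrder_iff.2 ⟨b, Fin.strictMono_iff_lt_succ.2 <| by simpa [Fin.forall_fin_succ] using hb,
      v, by ext k; fin_cases k <;> rfl⟩
  have h₁ := @ha 0 1 (by decide)
  have h₂ := @ha 1 2 (by decide)
  have h₃ := @ha 2 3 (by decide)
  rcases lt_trichotomy c (a 0) with h | rfl | h₀
  · exact .inr ⟨0, @cyclic ![c, a 0, a 1, a 2, a 3] ⟨h, h₁, h₂, h₃⟩ 1⟩
  · exact .inl ⟨0, rfl⟩
  rcases lt_trichotomy c (a 1) with h | rfl | h₁'
  · exact .inr ⟨1, @cyclic ![a 0, c, a 1, a 2, a 3] ⟨h₀, h, h₂, h₃⟩ 2⟩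
  · exact .inl ⟨1, rfl⟩
  rcases lt_trichotomy c (a 2) with h | rfl | h₂'
  · exact .inr ⟨2, @cyclic ![a 0, a 1, c, a 2, a 3] ⟨h₁, h₁', h, h₃⟩ 3⟩
  · exact .inl ⟨2, rfl⟩
  rcases lt_trichotomy c (a 3) with h | rfl | h₃'
  · exact .inr ⟨3, @cyclic ![a 0, a 1, a 2, c, a 3] ⟨h₁, h₂, h₂', h⟩ 4⟩
  · exact .inl ⟨3, rfl⟩
  · exact .inr ⟨0, @cyclic ![a 0, a 1, a 2, a 3, c] ⟨h₁, h₂, h₃, h₃'⟩ 0⟩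

theorem typeTwo_eq_zero {q q' : R} (hq : q = A ^ 2) (hq' : q' = ((A⁻¹ : Rˣ) : R) ^ 2)
    (hβ : (q + q') * β = 1) (hq₁ : q ^ 2 = 1) {a : Fin 4 → Fin n} (ha : StrictMono a)
    (c : Fin n) : typeTwo A β a c = 0 := by
  have hqq : q' = q := by
    linear_combination q * mul_eq_one_of_eq_sq hq hq' - q' * hq₁
  subst hqq
  rcases eq_or_cyclicOrder_of_strictMono ha c with ⟨v, rfl⟩ | ⟨v, hv⟩ <;>
    rw [← typeTwo_add_eq_zero (v := v)]
  · have h := s₂_mul_s₃_of_cyclicOrder_four hq hq' hβ (cyclicOrder_iff.2 ⟨a, ha, v, rfl⟩)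
    simp only [hq₁, sub_self, one_smul, add_sub_cancel_right, zero_pow two_ne_zero, zero_mul,
      zero_smul, zero_add] at h
    simp only [typeTwo, zero_add, s₂_comm _ (a v)]
    linear_combination (norm := module) -h
  · have h := s₂_mul_s₃_of_cyclicOrder_five hq hq' hβ hv
    simp only [hq₁, sub_self, one_smul, zero_smul] at h
    exact h

end

end Skein

theorem proposition4p8 {R : Type*} [CommRing R] (A : Rˣ) (q : Rˣ) (hq : q = A ^ 2)
    (β : R) (hβ : ((q : R) + ((q⁻¹ : Rˣ) : R)) * β = 1) (n : ℕ) :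
    (∀ i₁ i₂ i₃ i₄ i₅ : Fin n, Skein.CyclicOrder ![i₁, i₂, i₃, i₄, i₅] →
      (q : R) ^ 2 • (Skein.s₂ A β i₁ i₅ * Skein.s₃ A β i₂ i₃ i₄)
          - Skein.s₂ A β i₂ i₅ * Skein.s₃ A β i₁ i₃ i₄
          + Skein.s₂ A β i₃ i₅ * Skein.s₃ A β i₁ i₂ i₄
          - ((q⁻¹ : Rˣ) : R) ^ 2 • (Skein.s₂ A β i₄ i₅ * Skein.s₃ A β i₁ i₂ i₃)
        = ((q : R) - ((q⁻¹ : Rˣ) : R)) •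
            (((q⁻¹ : Rˣ) : R) • (Skein.s₂ A β i₁ i₂ * Skein.s₃ A β i₃ i₄ i₅)
              + (q : R) • (Skein.s₂ A β i₃ i₄ * Skein.s₃ A β i₁ i₂ i₅))) ∧
    (∀ i₁ i₂ i₃ i₄ : Fin n, Skein.CyclicOrder ![i₁, i₂, i₃, i₄] →
      (q : R) ^ 2 • (Skein.s₂ A β i₁ i₂ * Skein.s₃ A β i₁ i₃ i₄)
          - Skein.s₂ A β i₁ i₃ * Skein.s₃ A β i₁ i₂ i₄
          + ((q⁻¹ : Rˣ) : R) ^ 2 • (Skein.s₂ A β i₁ i₄ * Skein.s₃ A β i₁ i₂ i₃)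
          - ((q : R) ^ 2 + ((q⁻¹ : Rˣ) : R) ^ 2 - 1) •
              (Skein.s₂ A β i₁ i₁ * Skein.s₃ A β i₂ i₃ i₄)
        = (((q : R) - ((q⁻¹ : Rˣ) : R)) ^ 2 * β) •
            (Skein.t A {i₁} *
              (Skein.s₂ A β i₁ i₃ * Skein.s₂ A β i₂ i₄
                - (q : R) ^ 2 • (Skein.s₂ A β i₁ i₂ * Skein.s₂ A β i₃ i₄)
                - ((q⁻¹ : Rˣ) : R) ^ 2 • (Skein.s₂ A β i₁ i₄ * Skein.s₂ A β i₂ i₃)))) ∧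
    ((q : R) ^ 2 = 1 → ∀ c a₁ a₂ a₃ a₄ : Fin n, a₁ < a₂ → a₂ < a₃ → a₃ < a₄ →
      Skein.s₂ A β a₁ c * Skein.s₃ A β a₂ a₃ a₄ - Skein.s₂ A β a₂ c * Skein.s₃ A β a₁ a₃ a₄
        + Skein.s₂ A β a₃ c * Skein.s₃ A β a₁ a₂ a₄
        - Skein.s₂ A β a₄ c * Skein.s₃ A β a₁ a₂ a₃ = 0) := by
  have hq₁ : (q : R) = A ^ 2 := by rw [hq, Units.val_pow_eq_pow_val]
  have hq₂ : ((q⁻¹ : Rˣ) : R) = ((A⁻¹ : Rˣ) : R) ^ 2 := by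
    rw [hq, ← inv_pow, Units.val_pow_eq_pow_val]
  refine ⟨fun i₁ i₂ i₃ i₄ i₅ hi => Skein.s₂_mul_s₃_of_cyclicOrder_five hq₁ hq₂ hβ hi,
    fun i₁ i₂ i₃ i₄ hi => Skein.s₂_mul_s₃_of_cyclicOrder_four hq₁ hq₂ hβ hi,
    fun hq₃ c a₁ a₂ a₃ a₄ h₁ h₂ h₃ => Skein.typeTwo_eq_zero hq₁ hq₂ hβ hq₃
      (a := ![a₁, a₂, a₃, a₄]) (Fin.strictMono_iff_lt_succ.2 ?_) c⟩
  simpa [Fin.forall_fin_succ] using ⟨h₁, h₂, h₃⟩
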